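/- **Setting.** Let $\ell,e\ge 2$ be integers. For $x\ge 1$, an $x$-abacus is a subset $\mathcal A\subset\mathbb Z\times\{1,\dots,x\}$ (its elements, the black beads $(\beta,j)$, lie in column $\beta$ and row $j$; the other positions are white) for which there are $m_-,m_+\in\mathbb Z$ with $(\beta,j)\in\mathcal A$ for all $\beta\le m_-$ and all $j$, and $(\beta,j)\notin\mathcal A$ for all $\beta\ge m_+$ and all $j$. Its charge is $\mathbf s=(s_1,\dots,s_x)$, where $s_j$ is the column of the rightmost bead of row $j$ after all beads have been pushed to the left, that is, $s_j=\#\{\beta>0:(\beta,j)\in\mathcal A\}-\#\{\beta\le 0:(\beta,j)\notin\mathcal A\}$. If $\beta$ is the column of the $k$-th bead from the right in row $j$, put $\lambda^{(j)}_k=\beta-s_j+k-1$. This identifies $x$-abaci with charged $x$-partitions $|\lambda,\mathbf s\rangle$. **Level-rank duality.** The dual of an $\ell$-abacus $\mathcal A$ is the $e$-abacus $\dot{\mathcal A}$ such that, for $1\le j\le e$, $1\le r\le \ell$ and $m\in\mathbb Z$, one has $(r+\ell m,\,j)\in\dot{\mathcal A}$ if and only if $(j-e-em,\,r)\notin\mathcal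 A$ (stack copies of $\mathcal A$, each shifted $e$ steps to the right of the previous one; take the columns $1-e,\dots,0$; exchange the colours). With $e$ and $\ell$ exchanged, the same rule gives the inverse map. **Cylindric and FLOTW abaci.** An $\ell$-abacus $\mathcal A=|\lambda,\mathbf s\rangle$ is $e$-cylindric if $s_1\le\dots\le s_\ell\le s_1+e$ and, for all $k\ge1$, $\lambda^{(j)}_k\ge\lambda^{(j+1)}_{k+s_{j+1}-s_j}$ for $1\le j\le \ell-1$ and $\lambda^{(\ell)}_k\ge\lambda^{(1)}_{k+e+s_1-s_\ell}$. It is $e$-FLOTW if it is $e$-cylindric and, for every $\alpha\ge 1$, the set of residues modulo $e$ of the numbers $\lambda^{(j)}_k-k+s_j$ with $1\le j\le\ell$, $k\ge1$ and $\lambda^{(j)}_k=\alpha$ is not all of $\mathbb Z/e\mathbb Z$. **Crystals.** Let $x,y\ge2$. The $\widehat{\mathfrak{sl}}_y$-crystal on $x$-abaci has the following arrows, for $i\in\mathbb Z/y\mathbb Z$. Consider the positions $(\beta,j)$ with $\beta\equiv i$ mod $y$; such a position is addable (letter $A$) if $(\beta,j)$ is black and $(\beta+1,j)$ is white, and removable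 (letter $R$) if $(\beta,j)$ is white and $(\beta+1,j)$ is black. Order the addable and removable positions by $(\beta,j)\prec(\beta',j')$ iff $\beta<\beta'$, or $\beta=\beta'$ and $j>j'$. In the resulting word, read in increasing order, delete recursively all factors $RA$. If a letter $A$ is left, let $(\beta,j)$ be the position of the rightmost one; there is an arrow of colour $i$ from the abacus to the one obtained by moving the bead $(\beta,j)$ to $(\beta+1,j)$. The $\widehat{\mathfrak{sl}}_x$-crystal on $x$-abaci is defined by the same rule (with $x$ and $y$ exchanged) on the level-rank dual $y$-abaci. The first $y$-period of a set $S$ of beads is, if it exists, the sequence $((\beta_1,j_1),\dots,(\beta_y,j_y))$ in $S$ such that $\beta_1$ is the rightmost column containing a bead of $S$, $\beta_i=\beta_{i-1}-1$ and $j_i\le j_{i-1}$ for $2\le i\le y$, and $(\beta_i,j_0)\notin S$ whenever $j_0<j_i$. The $(k+1)$-st period of $S$ is the $k$-th period of $S$ minus its first period. The Heisenberg crystal on $x$-abaci (with respect to $y$; colours omitted) is the smallest set of arrows such that (i) there is an arrow $\mathcal B\to\mathcal C$ whenever $\mathcal B$ and $\mathcal C$ are sources for both Kac–Moody crystals and $\mathcal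 C$ is obtained from $\mathcal B$ by moving all beads of one $y$-period one step to the right (onto positions not occupied by beads outside this period); and (ii) if $\mathcal B\to\mathcal C$ is a Heisenberg arrow and $\mathcal B\to\mathcal B'$, $\mathcal C\to\mathcal C'$ are arrows of the same colour in the same Kac–Moody crystal, then $\mathcal B'\to\mathcal C'$ is a Heisenberg arrow. A source in a crystal is a vertex without incoming arrows. **Theorem.** Let $\mathcal A$ be an $\ell$-abacus, and consider its level-rank dual $e$-abacus $\dot{\mathcal A}$ in the $\widehat{\mathfrak{sl}}_\ell$-crystal and in the Heisenberg crystal on $e$-abaci ($x=e$, $y=\ell$). 1. $\mathcal A$ is $e$-cylindric if and only if $\dot{\mathcal A}$ is a source in the $\widehat{\mathfrak{sl}}_\ell$-crystal. 2. $\mathcal A$ is $e$-FLOTW if and only if $\dot{\mathcal A}$ is a source in the $\widehat{\mathfrak{sl}}_\ell$-crystal and in the Heisenberg crystal. -/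

import Mathlib

/-- An `x`-abacus: a set of black beads `(β, j)` (column `β`, row `j`), all black far to the left and
all white far to the right. The rows `1, …, x` are indexed by `Fin x`, that is, row number `j + 1`
is `j : Fin x`. -/
structure Abacus (x : ℕ) where
  carrier : Set (ℤ × Fin x)
  black_left : ∃ m : ℤ, ∀ β ≤ m, ∀ j : Fin x, (β, j) ∈ carrier
  white_right : ∃ m : ℤ, ∀ β ≥ m, ∀ j : Fin x, (β, j) ∉ carrier

namespace Abacus

/-! ### The charged multipartition of an abacus -/

/-- The charge: column of the rightmost bead of row `j` after all black beads have been pushed to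
the left, i.e. the number of black beads in positive columns minus the number of white beads in
non-positive columns. -/
noncomputable def charge {x : ℕ} (A : Abacus x) (j : Fin x) : ℤ :=
  ({β : ℤ | 0 < β ∧ (β, j) ∈ A.carrier}.ncard : ℤ) - {β : ℤ | β ≤ 0 ∧ (β, j) ∉ A.carrier}.ncard

/-- For `k ≥ 1`, the column of the `k`-th black bead of row `j`, counted from the right: the
largest column of a black bead with at least `k` black beads weakly to the right of it. -/
noncomputable def bead {x : ℕ} (A : Abacus x) (j : Fin x) (k : ℕ) : ℤ :=
  sSup {β : ℤ | (β, j) ∈ A.carrier ∧ k ≤ {γ : ℤ | β ≤ γ ∧ (γ, j) ∈ A.carrier}.ncard}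

/-- For `k ≥ 1`, the part `λ_k^{(j)} = β - s_j + k - 1` of the multipartition of `A`, where `β` is
the column of the `k`-th bead of row `j`. -/
noncomputable def part {x : ℕ} (A : Abacus x) (j : Fin x) (k : ℕ) : ℤ :=
  A.bead j k - A.charge j + k - 1

/-! ### Level-rank duality -/

/-- The filling of `ℤ²` by stacking copies of `A` on top of each other, each one shifted `e` steps
to the right: `(β, r)` belongs to it iff the bead in column `β` and row `r` is black. The copy with
`m = 0` is `A` itself, in rows `1, …, ℓ`. -/
def stack (e : ℕ) {ℓ : ℕ} (A : Abacus ℓ) : Set (ℤ × ℤ) :=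
  {p | ∃ (j : Fin ℓ) (m : ℤ), p.2 = (j : ℤ) + 1 + ℓ * m ∧ (p.1 - e * m, j) ∈ A.carrier}

/-- The level-rank dual `e`-abacus: the `e` consecutive columns `1 - e, …, 0` of the stacked
abacus, read as rows `1, …, e` of an abacus, with the colours exchanged. -/
def dual (e : ℕ) {ℓ : ℕ} [NeZero ℓ] (A : Abacus ℓ) : Abacus e where
  carrier := {p | ((p.2 : ℤ) + 1 - e, p.1) ∉ A.stack e}
  black_left := by
    obtain ⟨M, hM⟩ := A.white_right
    refine ⟨-((ℓ : ℤ) * (|M| + e + 1)), fun β hβ j => ?_⟩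
    rintro ⟨i, m, h1, h2⟩
    refine hM _ ?_ i h2
    have he : (1 : ℤ) ≤ e := by have := j.2; omega
    have hℓ : (1 : ℤ) ≤ ℓ := by have := i.2; omega
    have hi : (0 : ℤ) ≤ i := by positivity
    have hj : (0 : ℤ) ≤ j := by positivity
    have hMa := le_abs_self M
    have hMb := abs_nonneg M
    simp only at h1
    have hm : m ≤ -(|M| + e + 1) := by
      by_contra hc
      push Not at hc
      nlinarith
    nlinarith
  white_right := by
    obtain ⟨M, hM⟩ := A.black_left
    have hℓ : (1 : ℤ) ≤ ℓ := by have := NeZero.pos ℓ; omega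
    have hMa := neg_abs_le M
    have hMb := abs_nonneg M
    refine ⟨(ℓ : ℤ) * (|M| + 1) + 1, fun β hβ j => ?_⟩
    have he : (1 : ℤ) ≤ e := by have := j.2; omega
    have hj : (j : ℤ) + 1 ≤ e := by have := j.2; omega
    have h0 := Int.emod_nonneg (β - 1) (by omega : (ℓ : ℤ) ≠ 0)
    have h1 := Int.emod_lt_of_pos (β - 1) (by omega : (0 : ℤ) < ℓ)
    have h2 := Int.emod_add_mul_ediv (β - 1) ℓ
    simp only [Set.mem_ofPred_eq, not_not, stack]
    refine ⟨⟨((β - 1) % ℓ).toNat, by omega⟩, (β - 1) / ℓ, ?_, hM _ ?_ _⟩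
    · simp only [Int.toNat_of_nonneg h0]
      linarith
    · have hm : |M| + 1 ≤ (β - 1) / ℓ := by
        rw [Int.le_ediv_iff_mul_le (by omega)]
        linarith
      nlinarith

/-! ### Cylindric and FLOTW abaci -/

/-- The set `D(s)` of charges. -/
def D (ℓ e : ℕ) (s : ℤ) : Set (Fin ℓ → ℤ) :=
  {t | ∑ j, t j = s ∧ (∀ i j : Fin ℓ, i ≤ j → t i ≤ t j) ∧
    ∀ i j : Fin ℓ, (i : ℕ) = 0 → (j : ℕ) + 1 = ℓ → t j ≤ t i + e}

/-- `A` is `e`-cylindric: its charge `(s_1, …, s_ℓ)` lies in `D(s)`, where `s` is the sum of the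
`s_j`, `λ_k^{(j)} ≥ λ_{k + s_{j+1} - s_j}^{(j+1)}` for `1 ≤ j ≤ ℓ - 1` and
`λ_k^{(ℓ)} ≥ λ_{k + e + s_1 - s_ℓ}^{(1)}`, for all `k ≥ 1`. -/
def IsCylindric (e : ℕ) {ℓ : ℕ} (A : Abacus ℓ) : Prop :=
  A.charge ∈ D ℓ e (∑ j, A.charge j) ∧
  (∀ i j : Fin ℓ, (j : ℕ) = i + 1 → ∀ k k' : ℕ, 1 ≤ k →
    (k' : ℤ) = k + A.charge j - A.charge i → A.part j k' ≤ A.part i k) ∧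
  (∀ i j : Fin ℓ, (i : ℕ) = 0 → (j : ℕ) + 1 = ℓ → ∀ k k' : ℕ, 1 ≤ k →
    (k' : ℤ) = k + e + A.charge i - A.charge j → A.part i k' ≤ A.part j k)

/-- The set of residues modulo `e` of `λ_k^{(j)} - k + s_j`, over all parts
`λ_k^{(j)}` equal to `α`. -/
def residues (e : ℕ) {ℓ : ℕ} (A : Abacus ℓ) (α : ℤ) : Set (ZMod e) :=
  {c | ∃ (j : Fin ℓ) (k : ℕ), 1 ≤ k ∧ A.part j k = α ∧
    ((A.part j k - k + A.charge j : ℤ) : ZMod e) = c}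

/-- `A` is `e`-FLOTW. -/
def IsFLOTW (e : ℕ) {ℓ : ℕ} (A : Abacus ℓ) : Prop :=
  A.IsCylindric e ∧ ∀ α : ℤ, 0 < α → A.residues e α ≠ Set.univ

/-! ### The Kac–Moody crystals

The `sl_y`-hat crystal on `x`-abaci (level `x`). Adding a box of content `β` to the `j`-th partition
means moving the bead `(β, j)` to `(β + 1, j)`; this box is denoted by `(β, j)`. -/

/-- `b` is an addable `i`-box of `A`. -/
def IsAddable (y : ℕ) {x : ℕ} (i : ZMod y) (A : Abacus x) (b : ℤ × Fin x) : Prop :=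
  (b.1 : ZMod y) = i ∧ b ∈ A.carrier ∧ (b.1 + 1, b.2) ∉ A.carrier

/-- `b` is a removable `i`-box of `A`. -/
def IsRemovable (y : ℕ) {x : ℕ} (i : ZMod y) (A : Abacus x) (b : ℤ × Fin x) : Prop :=
  (b.1 : ZMod y) = i ∧ b ∉ A.carrier ∧ (b.1 + 1, b.2) ∈ A.carrier

/-- The order on boxes: `b ≺ c` iff the content of `b` is smaller than that of `c`, or
the contents are equal and `b` lies in a row with larger index. -/
def BoxLT {x : ℕ} (b c : ℤ × Fin x) : Prop :=
  b.1 < c.1 ∨ (b.1 = c.1 ∧ c.2 < b.2)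

/-- In the word of addable (`A`) and removable (`R`) `i`-boxes in increasing order, the letter `A`
of the box `c` survives the recursive deletion of all factors `RA`: for each removable
`d ≺ c`, there are at most as many `R`s as `A`s between `d` (included) and `c` (excluded). -/
def IsConormal (y : ℕ) {x : ℕ} (i : ZMod y) (A : Abacus x) (c : ℤ × Fin x) : Prop :=
  IsAddable y i A c ∧ ∀ d, IsRemovable y i A d → BoxLT d c →
    {b | IsRemovable y i A b ∧ (b = d ∨ BoxLT d b) ∧ BoxLT b c}.ncard ≤
      {b | IsAddable y i A b ∧ BoxLT d b ∧ BoxLT b c}.ncard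

/-- The good addable `i`-box: the largest (rightmost) surviving letter `A`. -/
def IsGoodAddable (y : ℕ) {x : ℕ} (i : ZMod y) (A : Abacus x) (c : ℤ × Fin x) : Prop :=
  IsConormal y i A c ∧ ∀ c', IsConormal y i A c' → c' = c ∨ BoxLT c' c

/-- The arrow `A → B` of colour `i` in the `sl_y`-hat crystal: `B` is obtained from `A` by adding
the good addable `i`-box. -/
def CrystalArrow (y : ℕ) {x : ℕ} (i : ZMod y) (A B : Abacus x) : Prop :=
  ∃ b, IsGoodAddable y i A b ∧ B.carrier = insert (b.1 + 1, b.2) (A.carrier \ {b})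

/-- `A` is a source in the `sl_y`-hat crystal. -/
def IsSource (y : ℕ) {x : ℕ} (A : Abacus x) : Prop :=
  ∀ (i : ZMod y) (B : Abacus x), ¬ CrystalArrow y i B A

/-! ### The Heisenberg crystal -/

/-- `P` is the first `y`-period of a set `S` of beads: it starts in the rightmost column
containing a bead of `S`, goes one column to the left and weakly down at each step, and consists of
the lowest beads of `S` in their columns. -/
def IsFirstPeriod (y : ℕ) {x : ℕ} (S : Set (ℤ × Fin x)) (P : Fin y → ℤ × Fin x) : Prop :=
  ∃ β : ℤ, IsGreatest {γ : ℤ | ∃ j, (γ, j) ∈ S} β ∧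
    (∀ i, (P i).1 = β - (i : ℤ)) ∧
    (∀ i i' : Fin y, i ≤ i' → (P i').2 ≤ (P i).2) ∧
    ∀ i, P i ∈ S ∧ ∀ j < (P i).2, ((P i).1, j) ∉ S

/-- `P` is the `k`-th `y`-period of `S` for some `k ≥ 1`. The `(k+1)`-st period of `S` is the `k`-th
period of `S` minus its first period. -/
inductive IsPeriod (y : ℕ) {x : ℕ} : Set (ℤ × Fin x) → (Fin y → ℤ × Fin x) → Prop
  | first {S : Set (ℤ × Fin x)} {P : Fin y → ℤ × Fin x} :
      IsFirstPeriod y S P → IsPeriod y S P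
  | next {S : Set (ℤ × Fin x)} {P Q : Fin y → ℤ × Fin x} :
      IsFirstPeriod y S P → IsPeriod y (S \ Set.range P) Q → IsPeriod y S Q

/-- `B` is obtained from `A` by shifting one of its `y`-periods one step to the right. -/
def IsPeriodShift (y : ℕ) {x : ℕ} (A B : Abacus x) : Prop :=
  ∃ P : Fin y → ℤ × Fin x, IsPeriod y A.carrier P ∧
    Disjoint (Set.range fun i => ((P i).1 + 1, (P i).2)) (A.carrier \ Set.range P) ∧
    B.carrier = (A.carrier \ Set.range P) ∪ Set.range fun i => ((P i).1 + 1, (P i).2)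

/-- `A` is a source in both Kac–Moody crystals: the `sl_y`-hat crystal on `x`-abaci and the
`sl_x`-hat crystal, which acts on the level-rank dual `y`-abacus. -/
def IsDoubleSource (y : ℕ) {x : ℕ} [NeZero x] (A : Abacus x) : Prop :=
  IsSource y A ∧ IsSource x (A.dual y)

/-- The arrows `A → B` of the Heisenberg crystal on `x`-abaci (with respect to `y`). Between sources
of both Kac–Moody crystals, an arrow shifts one `y`-period one step to the right. The other arrows
are determined by the commutation of the Heisenberg crystal with the two Kac–Moody crystals. (The
colours of the arrows are irrelevant for sources and are not recorded.) -/
inductive HeisenbergArrow (y : ℕ) {x : ℕ} [NeZero x] : Abacus x → Abacus x → Prop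
  | shift {A B : Abacus x} :
      IsDoubleSource y A → IsDoubleSource y B → IsPeriodShift y A B → HeisenbergArrow y A B
  | commute {A B A' B' : Abacus x} (i : ZMod y) :
      HeisenbergArrow y A B → CrystalArrow y i A A' → CrystalArrow y i B B' →
      HeisenbergArrow y A' B'
  | commute_dual {A B A' B' : Abacus x} (i : ZMod x) :
      HeisenbergArrow y A B → CrystalArrow x i (A.dual y) (A'.dual y) →
      CrystalArrow x i (B.dual y) (B'.dual y) → HeisenbergArrow y A' B'

/-- `A` is a source in the Heisenberg crystal. -/
def IsHeisenbergSource (y : ℕ) {x : ℕ} [NeZero x] (A : Abacus x) : Prop :=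
  ∀ B : Abacus x, ¬ HeisenbergArrow y B A

end Abacus

/-! Everything is read off the stacked filling of the plane, which is invariant under translation by
`e` columns and `ℓ` rows. Duality transposes it and exchanges colours, so counting beads down a
column of the dual is counting white positions to the left in a row of the original: this is the
`height` (`depth_dual`). The boxes of one residue become the rows of one column of the stack, and
the signature rule becomes a statement about the walk `potential` (addable minus removable boxes
below a row). The good box sits at the last minimum of the walk, and an abacus is a source iff no
walk becomes negative (`isSource_iff`). For the dual, the values of the walk are differences of
heights of consecutive rows. Hence the dual is a source iff heights decrease from row to row, and in
terms of parts this is the cylindric condition (`part_le_part_iff`, `isCylindric_iff`).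

A cylindric filling is described by the curves `level` for `a > 0`. The beads of height `a` in
column `c` fill the gap between level `a + 1` at `c + 1` and level `a` at `c`; FLOTW means that for
each `a > 0` some gap is empty (`isFull_iff`). Between consecutive levels the walk is concave, so
only its values at the levels matter, and two successive values differ by the difference of two
adjacent gaps (`levelPotential_sub`). An arrow of the crystal on `A` raises one level by one on one
residue class of columns, and fullness is invariant along arrows.

If `a` is full, level `a` can be lowered by one in all columns. This leaves the level potentials
unchanged, hence commutes with the arrows and preserves sources; in the dual it is the shift of a
period (`IsLowering.isPeriodShift`). Going down to a source and back up produces an incoming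
Heisenberg arrow. Conversely, a period shift forces a bead of positive height, and at a source the
largest bead height is then full (`exists_isFull_of_isSource`); transport along arrows excludes
Heisenberg arrows into duals of FLOTW abaci. -/

namespace Abacus

/-! ### Counting the elements of a set of integers below a bound -/

/-- The number of elements of `s` that are smaller than `n`. -/
noncomputable def below (s : Set ℤ) (n : ℤ) : ℤ := ((s ∩ Set.Iio n).ncard : ℤ)

theorem below_nonneg (s : Set ℤ) (n : ℤ) : 0 ≤ below s n := by
  unfold below; positivity

theorem finite_inter_Iio {s : Set ℤ} (hs : BddBelow s) (n : ℤ) : (s ∩ Set.Iio n).Finite := by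
  obtain ⟨m, hm⟩ := hs
  exact (Set.finite_Ico m n).subset fun k hk => ⟨hm hk.1, hk.2⟩

theorem below_succ_of_mem {s : Set ℤ} (hs : BddBelow s) {n : ℤ} (hn : n ∈ s) :
    below s (n + 1) = below s n + 1 := by
  have : s ∩ Set.Iio (n + 1) = insert n (s ∩ Set.Iio n) := by
    ext k
    simp only [Set.mem_inter_iff, Set.mem_Iio, Set.mem_insert_iff, Int.lt_add_one_iff,
      le_iff_lt_or_eq]
    constructor
    · rintro ⟨h1, h2 | h2⟩
      exacts [Or.inr ⟨h1, h2⟩, Or.inl h2]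
    · rintro (rfl | ⟨h1, h2⟩)
      exacts [⟨hn, Or.inr rfl⟩, ⟨h1, Or.inl h2⟩]
  unfold below
  rw [this, Set.ncard_insert_of_notMem (fun h => lt_irrefl n h.2) (finite_inter_Iio hs n)]
  push_cast; ring

theorem below_succ_of_notMem {s : Set ℤ} {n : ℤ} (hn : n ∉ s) :
    below s (n + 1) = below s n := by
  have : s ∩ Set.Iio (n + 1) = s ∩ Set.Iio n := by
    ext k
    simp only [Set.mem_inter_iff, Set.mem_Iio, Int.lt_add_one_iff, le_iff_lt_or_eq]
    constructor
    · rintro ⟨h1, h2 | rfl⟩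
      exacts [⟨h1, h2⟩, absurd h1 hn]
    · rintro ⟨h1, h2⟩
      exact ⟨h1, Or.inl h2⟩
  unfold below
  rw [this]

theorem below_eq_zero {s : Set ℤ} {n : ℤ} (h : ∀ k ∈ s, n ≤ k) : below s n = 0 := by
  have : s ∩ Set.Iio n = ∅ := by
    ext k
    simp only [Set.mem_inter_iff, Set.mem_Iio, Set.mem_empty_iff_false, iff_false, not_and, not_lt]
    exact h k
  simp [below, this]

theorem below_shift (s : Set ℤ) (n a : ℤ) : below {k | k + a ∈ s} n = below s (n + a) := by
  have : s ∩ Set.Iio (n + a) = (fun k => k + a) '' ({k | k + a ∈ s} ∩ Set.Iio n) := by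
    ext k
    simp only [Set.mem_inter_iff, Set.mem_Iio, Set.mem_image, Set.mem_ofPred_eq]
    constructor
    · rintro ⟨h1, h2⟩
      exact ⟨k - a, ⟨by simpa using h1, by linarith⟩, by ring⟩
    · rintro ⟨k, ⟨h1, h2⟩, rfl⟩
      exact ⟨h1, by linarith⟩
  unfold below
  rw [this, Set.ncard_image_of_injective _ (add_left_injective a)]

/-- Two functions on the integers with the same increments that agree somewhere are equal. -/
theorem eq_of_increments {f g : ℤ → ℤ} (m : ℤ) (hm : f m = g m)
    (h : ∀ n, f (n + 1) - f n = g (n + 1) - g n) : f = g := by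
  funext n
  rcases le_total m n with hn | hn
  · induction n, hn using Int.leInduction with
    | base => exact hm
    | succ n _ ih => linarith [h n]
  · induction n, hn using Int.leInductionDown with
    | base => exact hm
    | pred n _ ih =>
      have := h (n - 1)
      rw [sub_add_cancel] at this
      linarith

/-! ### The stacked abacus -/

theorem exists_row {x : ℕ} [NeZero x] (R : ℤ) : ∃ (j : Fin x) (m : ℤ), R = (j : ℤ) + 1 + x * m := by
  have hx : (0 : ℤ) < x := by exact_mod_cast NeZero.pos x
  have h0 := Int.emod_nonneg (R - 1) hx.ne'
  have h1 := Int.emod_lt_of_pos (R - 1) hx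
  have h2 := Int.emod_add_mul_ediv (R - 1) x
  refine ⟨⟨((R - 1) % x).toNat, by omega⟩, (R - 1) / x, ?_⟩
  simp only [Int.toNat_of_nonneg h0]
  linarith

theorem row_unique {x : ℕ} {j j' : Fin x} {m m' : ℤ}
    (h : (j : ℤ) + 1 + x * m = (j' : ℤ) + 1 + x * m') : j = j' ∧ m = m' := by
  have h1 := j.2
  have h2 := j'.2
  have hm : m = m' := by
    rcases lt_trichotomy m m' with hlt | heq | hlt
    · nlinarith
    · exact heq
    · nlinarith
  subst hm
  exact ⟨Fin.ext (by omega), rfl⟩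

theorem mem_stack {x : ℕ} (y : ℕ) (A : Abacus x) (c : ℤ) (j : Fin x) (m : ℤ) :
    (c, (j : ℤ) + 1 + x * m) ∈ A.stack y ↔ (c - y * m, j) ∈ A.carrier := by
  constructor
  · rintro ⟨j', m', h1, h2⟩
    obtain ⟨rfl, rfl⟩ := row_unique h1
    exact h2
  · intro h
    exact ⟨j, m, rfl, h⟩

theorem mem_stack_zero {x : ℕ} (y : ℕ) (A : Abacus x) (c : ℤ) (j : Fin x) :
    (c, (j : ℤ) + 1) ∈ A.stack y ↔ (c, j) ∈ A.carrier := by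
  simpa using mem_stack y A c j 0

theorem stack_periodic {x : ℕ} [NeZero x] (y : ℕ) (A : Abacus x) (c R n : ℤ) :
    (c + y * n, R + x * n) ∈ A.stack y ↔ (c, R) ∈ A.stack y := by
  obtain ⟨j, m, rfl⟩ := exists_row (x := x) R
  have : (j : ℤ) + 1 + x * m + x * n = j + 1 + x * (m + n) := by ring
  rw [this, mem_stack, mem_stack]
  have : c + y * n - y * (m + n) = c - y * m := by ring
  rw [this]

theorem stack_injective {x : ℕ} (y : ℕ) {A B : Abacus x} (h : A.stack y = B.stack y) : A = B := by
  have : A.carrier = B.carrier := by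
    ext ⟨c, j⟩
    rw [← mem_stack_zero y, ← mem_stack_zero y, h]
  cases A; cases B; congr

theorem exists_bound_left {x : ℕ} [NeZero x] (y : ℕ) (A : Abacus x) (R : ℤ) :
    ∃ M, ∀ c ≤ M, (c, R) ∈ A.stack y := by
  obtain ⟨j, m, rfl⟩ := exists_row (x := x) R
  obtain ⟨M, hM⟩ := A.black_left
  exact ⟨M + y * m, fun c hc => (mem_stack ..).2 (hM _ (by linarith) _)⟩

theorem exists_bound_right {x : ℕ} [NeZero x] (y : ℕ) (A : Abacus x) (R : ℤ) :
    ∃ M, ∀ c ≥ M, (c, R) ∉ A.stack y := by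
  obtain ⟨j, m, rfl⟩ := exists_row (x := x) R
  obtain ⟨M, hM⟩ := A.white_right
  exact ⟨M + y * m, fun c hc h => hM _ (by linarith) _ ((mem_stack ..).1 h)⟩

theorem exists_bound_down {x : ℕ} [NeZero x] {y : ℕ} (hy : 0 < y) (A : Abacus x) (c : ℤ) :
    ∃ M, ∀ R ≤ M, (c, R) ∉ A.stack y := by
  obtain ⟨N, hN⟩ := A.white_right
  have hx : (0 : ℤ) < x := by exact_mod_cast NeZero.pos x
  refine ⟨-x * (|N| + |c|), fun R hR h => ?_⟩
  obtain ⟨j, m, rfl⟩ := exists_row (x := x) R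
  refine hN _ ?_ _ ((mem_stack ..).1 h)
  have h1 := le_abs_self N
  have h2 := neg_abs_le c
  have h3 := abs_nonneg N
  have h4 := abs_nonneg c
  have hy' : (1 : ℤ) ≤ y := by omega
  have hm : m ≤ -(|N| + |c|) := by
    by_contra hc
    push Not at hc
    have : (0 : ℤ) ≤ j := by positivity
    nlinarith
  nlinarith

theorem exists_bound_up {x : ℕ} [NeZero x] {y : ℕ} (hy : 0 < y) (A : Abacus x) (c : ℤ) :
    ∃ M, ∀ R ≥ M, (c, R) ∈ A.stack y := by
  obtain ⟨N, hN⟩ := A.black_left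
  have hx : (0 : ℤ) < x := by exact_mod_cast NeZero.pos x
  refine ⟨x * (|N| + |c| + 1) + 1, fun R hR => ?_⟩
  obtain ⟨j, m, rfl⟩ := exists_row (x := x) R
  refine (mem_stack ..).2 (hN _ ?_ _)
  have h1 := neg_abs_le N
  have h2 := le_abs_self c
  have h3 := abs_nonneg N
  have h4 := abs_nonneg c
  have hy' : (1 : ℤ) ≤ y := by omega
  have hm : |N| + |c| ≤ m := by
    by_contra hc
    push Not at hc
    have : (j : ℤ) + 1 ≤ x := by have := j.2; omega
    nlinarith
  nlinarith

/-! ### Heights, depths and potentials. -/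

/-- The number of white positions of row `R` of the stacked abacus left of column `c`. For a bead
in column `c` this is the corresponding part of the multipartition. -/
noncomputable def height {x : ℕ} (y : ℕ) (A : Abacus x) (c R : ℤ) : ℤ :=
  below {γ | (γ, R) ∉ A.stack y} c

/-- The number of black positions of column `c` of the stacked abacus below row `r`. -/
noncomputable def depth {x : ℕ} (y : ℕ) (A : Abacus x) (c r : ℤ) : ℤ :=
  below {R | (c, R) ∈ A.stack y} r

/-- The number of addable minus the number of removable boxes in the part of the word of colour `i`
given by the rows below `r` of the stacked abacus. -/
noncomputable def potential {x : ℕ} (y : ℕ) (A : Abacus x) (i r : ℤ) : ℤ :=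
  A.depth y i r - A.depth y (i + 1) r

theorem height_succ_of_mem {x : ℕ} (y : ℕ) (A : Abacus x) {c R : ℤ} (h : (c, R) ∈ A.stack y) :
    A.height y (c + 1) R = A.height y c R :=
  below_succ_of_notMem fun h' => h' h

theorem height_nonneg {x : ℕ} (y : ℕ) (A : Abacus x) (c R : ℤ) :
    0 ≤ A.height y c R := below_nonneg _ _

section height

variable {x : ℕ} [NeZero x] (y : ℕ) (A : Abacus x)

theorem bddBelow_white (R : ℤ) : BddBelow {γ | (γ, R) ∉ A.stack y} := by
  obtain ⟨M, hM⟩ := exists_bound_left y A R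
  exact ⟨M, fun k hk => le_of_not_ge fun h => hk (hM k h)⟩

theorem height_succ_of_notMem {c R : ℤ} (h : (c, R) ∉ A.stack y) :
    A.height y (c + 1) R = A.height y c R + 1 :=
  below_succ_of_mem (bddBelow_white y A R) h

theorem mem_stack_iff_height (c R : ℤ) :
    (c, R) ∈ A.stack y ↔ A.height y (c + 1) R = A.height y c R := by
  by_cases h : (c, R) ∈ A.stack y
  · simp [h, height_succ_of_mem]
  · simp [h, height_succ_of_notMem]

theorem height_succ_cases (c R : ℤ) :
    A.height y (c + 1) R = A.height y c R ∨ A.height y (c + 1) R = A.height y c R + 1 := by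
  by_cases h : (c, R) ∈ A.stack y
  · exact Or.inl (height_succ_of_mem y A h)
  · exact Or.inr (height_succ_of_notMem y A h)

theorem height_mono {c c' : ℤ} (h : c ≤ c') (R : ℤ) : A.height y c R ≤ A.height y c' R := by
  induction c', h using Int.leInduction with
  | base => exact le_rfl
  | succ n _ ih => rcases height_succ_cases y A n R with h | h <;> omega

theorem exists_height_eq_zero (R : ℤ) : ∃ M, ∀ c ≤ M, A.height y c R = 0 := by
  obtain ⟨M, hM⟩ := exists_bound_left y A R
  exact ⟨M, fun c hc => below_eq_zero fun k hk => le_of_not_gt fun h => hk (hM k (by omega))⟩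

theorem height_periodic (c R n : ℤ) :
    A.height y (c + y * n) (R + x * n) = A.height y c R := by
  unfold height
  rw [← below_shift]
  congr 1
  ext k
  simp only [Set.mem_ofPred_eq, stack_periodic]

variable {A} in
/-- The height function is determined by its increments. -/
theorem height_eq_of_increments {R : ℤ} {f : ℤ → ℤ} (h0 : ∃ M, ∀ c ≤ M, f c = 0)
    (h1 : ∀ c, (c, R) ∈ A.stack y → f (c + 1) = f c)
    (h2 : ∀ c, (c, R) ∉ A.stack y → f (c + 1) = f c + 1) (c : ℤ) : A.height y c R = f c := by
  obtain ⟨M, hM⟩ := h0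
  obtain ⟨N, hN⟩ := exists_height_eq_zero y A R
  refine congrFun (eq_of_increments (f := fun c => A.height y c R) (min M N) ?_ fun c => ?_) c
  · rw [hM _ (min_le_left _ _), hN _ (min_le_right _ _)]
  · by_cases h : (c, R) ∈ A.stack y
    · rw [height_succ_of_mem y A h, h1 c h]; ring
    · rw [height_succ_of_notMem y A h, h2 c h]; ring

variable {y}

theorem bddBelow_black (hy : 0 < y) (c : ℤ) : BddBelow {R | (c, R) ∈ A.stack y} := by
  obtain ⟨M, hM⟩ := exists_bound_down hy A c
  exact ⟨M, fun k hk => le_of_not_ge fun h => hM k h hk⟩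

open Classical in
theorem depth_succ (hy : 0 < y) (c r : ℤ) :
    A.depth y c (r + 1) = A.depth y c r + if (c, r) ∈ A.stack y then 1 else 0 := by
  split_ifs with h
  · exact below_succ_of_mem (bddBelow_black A hy c) h
  · rw [add_zero]; exact below_succ_of_notMem h

open Classical in
theorem potential_succ (hy : 0 < y) (i r : ℤ) :
    A.potential y i (r + 1) = A.potential y i r + (if (i, r) ∈ A.stack y then 1 else 0) -
      if (i + 1, r) ∈ A.stack y then 1 else 0 := by
  unfold potential
  rw [depth_succ A hy, depth_succ A hy]; ring

theorem exists_potential_eq_zero (hy : 0 < y) (i : ℤ) : ∃ M, ∀ r ≤ M, A.potential y i r = 0 := by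
  obtain ⟨M, hM⟩ := exists_bound_down hy A i
  obtain ⟨N, hN⟩ := exists_bound_down hy A (i + 1)
  refine ⟨min M N, fun r hr => ?_⟩
  have h1 : A.depth y i r = 0 :=
    below_eq_zero fun k hk => le_of_not_gt fun h => hM k (by omega) hk
  have h2 : A.depth y (i + 1) r = 0 :=
    below_eq_zero fun k hk => le_of_not_gt fun h => hN k (by omega) hk
  rw [potential, h1, h2, sub_zero]

theorem exists_potential_const (hy : 0 < y) (i : ℤ) :
    ∃ M, ∀ r ≥ M, A.potential y i r = A.potential y i M := by
  obtain ⟨M, hM⟩ := exists_bound_up hy A i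
  obtain ⟨N, hN⟩ := exists_bound_up hy A (i + 1)
  refine ⟨max M N, fun r hr => ?_⟩
  induction r, hr using Int.leInduction with
  | base => rfl
  | succ n hn ih =>
    rw [potential_succ A hy, ih, if_pos (hM n (by omega)), if_pos (hN n (by omega))]; ring

end height

/-! ### The dual of the stacked abacus -/

theorem mem_stack_dual {ℓ : ℕ} [NeZero ℓ] {e : ℕ} [NeZero e] (A : Abacus ℓ) (β R : ℤ) :
    (β, R) ∈ (A.dual e).stack ℓ ↔ (R - e, β) ∉ A.stack e := by
  obtain ⟨j, m, rfl⟩ := exists_row (x := e) R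
  rw [mem_stack]
  have : ((j : ℤ) + 1 + e * m - e, β) = ((j : ℤ) + 1 - e + e * m, β - ℓ * m + ℓ * m) := by
    ext <;> ring
  rw [this, stack_periodic]
  rfl

/-- Two transpositions translate the stack by `e` columns and `ℓ` rows, which is one of its periods.
-/
theorem dual_dual {ℓ : ℕ} [NeZero ℓ] {e : ℕ} [NeZero e] (A : Abacus ℓ) :
    (A.dual e).dual ℓ = A := by
  refine stack_injective e (Set.ext fun ⟨c, R⟩ => ?_)
  rw [mem_stack_dual, mem_stack_dual, not_not]
  have := stack_periodic e A c R (-1)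
  rw [← this]
  have h : (c - e, R - ℓ) = (c + e * (-1), R + ℓ * (-1)) := by ext <;> ring
  rw [h]

/-- The bridge between the two sides: it turns the potentials of the dual into differences of
heights of adjacent rows. -/
theorem depth_dual {ℓ : ℕ} [NeZero ℓ] {e : ℕ} [NeZero e] (A : Abacus ℓ) (c r : ℤ) :
    (A.dual e).depth ℓ c r = A.height e (r - e) c := by
  unfold depth height
  rw [sub_eq_add_neg, ← below_shift]
  congr 1
  ext k
  simp only [Set.mem_ofPred_eq, mem_stack_dual, sub_eq_add_neg]

/-! ### Boxes of a fixed residue as rows of the stacked abacus -/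

section box

variable {x : ℕ} [NeZero x]

/-- The box of the abacus that corresponds to column `i` and row `R` of the stacked abacus. -/
noncomputable def box (y : ℕ) (i R : ℤ) : ℤ × Fin x :=
  (i - y * (exists_row (x := x) R).choose_spec.choose, (exists_row (x := x) R).choose)

theorem exists_box_eq (y : ℕ) (i R : ℤ) :
    ∃ (j : Fin x) (m : ℤ), R = (j : ℤ) + 1 + x * m ∧ box y i R = (i - y * m, j) :=
  ⟨_, _, (exists_row (x := x) R).choose_spec.choose_spec, rfl⟩

theorem box_eq_iff (y : ℕ) (i R c : ℤ) (j : Fin x) (m : ℤ) :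
    (c - y * m, j) = box y i R ↔ ∃ n, c = i + y * n ∧ (j : ℤ) + 1 + x * m = R + x * n := by
  obtain ⟨j', m', h, hb⟩ := exists_box_eq (x := x) y i R
  rw [hb, Prod.mk.injEq]
  constructor
  · rintro ⟨h1, rfl⟩
    exact ⟨m - m', by linarith, by rw [h]; ring⟩
  · rintro ⟨n, rfl, h2⟩
    rw [h] at h2
    obtain ⟨rfl, rfl⟩ := row_unique (j := j) (m := m) (j' := j') (m' := m' + n) (by linarith)
    exact ⟨by ring, rfl⟩

theorem box_mem (y : ℕ) (A : Abacus x) (i R : ℤ) :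
    box y i R ∈ A.carrier ↔ (i, R) ∈ A.stack y := by
  obtain ⟨j, m, h1, h2⟩ := exists_box_eq (x := x) y i R
  rw [h2, h1, mem_stack]

theorem box_succ_mem (y : ℕ) (A : Abacus x) (i R : ℤ) :
    ((box (x := x) y i R).1 + 1, (box (x := x) y i R).2) ∈ A.carrier ↔
      (i + 1, R) ∈ A.stack y := by
  obtain ⟨j, m, h1, h2⟩ := exists_box_eq (x := x) y i R
  have : i - y * m + 1 = i + 1 - y * m := by ring
  rw [h2, h1, mem_stack, this]

theorem box_residue (y : ℕ) (i R : ℤ) : ((box (x := x) y i R).1 : ZMod y) = i := by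
  obtain ⟨j, m, h1, h2⟩ := exists_box_eq (x := x) y i R
  simp [h2]

theorem exists_eq_box {y : ℕ} {i : ℤ} {b : ℤ × Fin x} (h : (b.1 : ZMod y) = i) :
    ∃ R, b = box y i R := by
  obtain ⟨m, hm⟩ := (ZMod.intCast_eq_intCast_iff_dvd_sub _ _ _).1 h
  refine ⟨(b.2 : ℤ) + 1 + x * m, ?_⟩
  rw [show b = (i - y * m, b.2) by ext; · linarith
                                   · rfl]
  rw [box_eq_iff]
  exact ⟨0, by ring, by ring⟩

/-- Passing to the next copy of the abacus raises the row and lowers the content by `y`. The crystal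
word therefore reads the rows from top to bottom. -/
theorem boxLT_box {y : ℕ} (hy : 0 < y) (i R R' : ℤ) :
    BoxLT (box (x := x) y i R) (box y i R') ↔ R' < R := by
  obtain ⟨j, m, h1, h2⟩ := exists_box_eq (x := x) y i R
  obtain ⟨j', m', h1', h2'⟩ := exists_box_eq (x := x) y i R'
  rw [h2, h2', BoxLT, h1, h1']
  simp only [Fin.lt_def]
  have hj := j.2
  have hj' := j'.2
  have hy' : (0 : ℤ) < y := by exact_mod_cast hy
  rcases lt_trichotomy m m' with h | rfl | h
  · have a1 : y * m < y * m' := by nlinarith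
    have a2 : (x : ℤ) * (m + 1) ≤ x * m' := by nlinarith
    exact ⟨fun h => by rcases h with h | h <;> linarith, fun _ => by nlinarith⟩
  · constructor <;> intro <;> omega
  · have a1 : y * m' < y * m := by nlinarith
    have a2 : (x : ℤ) * (m' + 1) ≤ x * m := by nlinarith
    refine ⟨fun _ => by nlinarith, fun _ => Or.inl (by linarith)⟩

theorem box_injective {y : ℕ} (hy : 0 < y) (i : ℤ) :
    Function.Injective (box (x := x) y i) := by
  intro R R' h
  have h1 := boxLT_box (x := x) hy i R R'
  have h2 := boxLT_box (x := x) hy i R' R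
  rw [h] at h1 h2
  have : ¬ BoxLT (box (x := x) y i R') (box y i R') := by simp [BoxLT]
  exact le_antisymm (not_lt.1 fun h' => this (h1.2 h')) (not_lt.1 fun h' => this (h2.2 h'))

theorem isAddable_box (y : ℕ) (A : Abacus x) (i R : ℤ) :
    IsAddable y (i : ZMod y) A (box y i R) ↔ (i, R) ∈ A.stack y ∧ (i + 1, R) ∉ A.stack y := by
  rw [IsAddable, box_mem, box_succ_mem, and_iff_right (box_residue y i R)]

theorem isRemovable_box (y : ℕ) (A : Abacus x) (i R : ℤ) :
    IsRemovable y (i : ZMod y) A (box y i R) ↔ (i, R) ∉ A.stack y ∧ (i + 1, R) ∈ A.stack y := by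
  rw [IsRemovable, box_mem, box_succ_mem, and_iff_right (box_residue y i R)]

theorem ncard_boxes {y : ℕ} (hy : 0 < y) (i : ℤ) {s : Set (ℤ × Fin x)} {t : Finset ℤ}
    (hs : ∀ b ∈ s, (b.1 : ZMod y) = i) (h : ∀ R, box y i R ∈ s ↔ R ∈ t) : s.ncard = t.card := by
  have : s = box y i '' (t : Set ℤ) := by
    ext b
    constructor
    · intro hb
      obtain ⟨R, rfl⟩ := exists_eq_box (hs b hb)
      exact ⟨R, (h R).1 hb, rfl⟩
    · rintro ⟨R, hR, rfl⟩
      exact (h R).2 hR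
  rw [this, Set.ncard_image_of_injective _ (box_injective hy i), Set.ncard_coe_finset]

open Classical in
theorem potential_sub {y : ℕ} (hy : 0 < y) (A : Abacus x) (i : ℤ) {m n : ℤ} (hmn : m ≤ n) :
    A.potential y i n - A.potential y i m =
      ((Finset.Ico m n).filter fun R => (i, R) ∈ A.stack y ∧ (i + 1, R) ∉ A.stack y).card -
      ((Finset.Ico m n).filter fun R => (i, R) ∉ A.stack y ∧ (i + 1, R) ∈ A.stack y).card := by
  induction n, hmn using Int.leInduction with
  | base => simp
  | succ n hn ih =>
    have : Finset.Ico m (n + 1) = insert n (Finset.Ico m n) := by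
      ext k; simp only [Finset.mem_Ico, Finset.mem_insert]; omega
    rw [this, Finset.filter_insert, Finset.filter_insert, potential_succ A hy]
    by_cases h1 : (i, n) ∈ A.stack y <;> by_cases h2 : (i + 1, n) ∈ A.stack y <;>
      simp only [h1, h2, not_true_eq_false, not_false_eq_true, and_true, and_false,
        if_true, if_false] <;>
      (try rw [Finset.card_insert_of_notMem (by simp)]) <;> (try push_cast) <;> linarith

/-- The deletion rule gives an inequality only at removable boxes. No other row lowers the
potential, so the inequality propagates to all rows above `g`. -/
theorem isConormal_box {y : ℕ} (hy : 0 < y) (A : Abacus x) (i g : ℤ) :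
    IsConormal y (i : ZMod y) A (box y i g) ↔
      ((i, g) ∈ A.stack y ∧ (i + 1, g) ∉ A.stack y) ∧
      ∀ d > g, A.potential y i (g + 1) ≤ A.potential y i d := by
  classical
  rw [IsConormal, isAddable_box]
  refine and_congr_right fun _ => ?_
  have key : ∀ d > g, IsRemovable y (i : ZMod y) A (box y i d) →
      ({b | IsRemovable y (i : ZMod y) A b ∧ (b = box y i d ∨ BoxLT (box y i d) b) ∧
        BoxLT b (box y i g)}.ncard ≤
      {b | IsAddable y (i : ZMod y) A b ∧ BoxLT (box y i d) b ∧ BoxLT b (box y i g)}.ncard ↔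
      A.potential y i (g + 1) ≤ A.potential y i (d + 1)) := by
    intro d hd hr
    rw [isRemovable_box] at hr
    rw [ncard_boxes (t := (Finset.Ico (g + 1) (d + 1)).filter
        fun R => (i, R) ∉ A.stack y ∧ (i + 1, R) ∈ A.stack y) hy i,
      ncard_boxes (t := (Finset.Ico (g + 1) (d + 1)).filter
        fun R => (i, R) ∈ A.stack y ∧ (i + 1, R) ∉ A.stack y) hy i]
    · have := potential_sub hy A i (show g + 1 ≤ d + 1 by omega)
      omega
    · exact fun b hb => hb.1.1
    · intro R
      simp only [Set.mem_ofPred_eq, isAddable_box, boxLT_box hy, Finset.mem_filter, Finset.mem_Ico]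
      constructor
      · rintro ⟨h1, h2, h3⟩
        exact ⟨⟨by omega, by omega⟩, h1⟩
      · rintro ⟨⟨h1, h2⟩, h3⟩
        have : R ≠ d := by rintro rfl; exact hr.1 h3.1
        exact ⟨h3, by omega, by omega⟩
    · exact fun b hb => hb.1.1
    · intro R
      simp only [Set.mem_ofPred_eq, isRemovable_box, boxLT_box hy, Finset.mem_filter,
        Finset.mem_Ico, (box_injective hy i).eq_iff]
      constructor
      · rintro ⟨h1, h2, h3⟩
        exact ⟨⟨by omega, by omega⟩, h1⟩
      · rintro ⟨⟨h1, h2⟩, h3⟩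
        exact ⟨h3, by omega, by omega⟩
  constructor
  · intro h d hd
    have hd' : g + 1 ≤ d := hd
    induction d, hd' using Int.leInduction with
    | base => exact le_rfl
    | succ d hd'' ih =>
      by_cases hr : IsRemovable y (i : ZMod y) A (box y i d)
      · exact (key d hd'' hr).1 (h _ hr ((boxLT_box hy ..).2 hd''))
      · have ih := ih hd''
        rw [isRemovable_box] at hr
        rw [potential_succ A hy i d]
        split_ifs <;> first | omega | (exfalso; tauto)
  · intro h d hr hlt
    obtain ⟨d, rfl⟩ := exists_eq_box hr.1
    rw [boxLT_box hy] at hlt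
    exact (key d hlt hr).2 (h _ (by omega))

/-- `g` is the last position where `u` attains its minimum. -/
def IsLastArgmin (u : ℤ → ℤ) (g : ℤ) : Prop := (∀ d ≤ g, u g ≤ u d) ∧ ∀ d > g, u g < u d

theorem IsLastArgmin.letter {y : ℕ} (hy : 0 < y) {A : Abacus x} {i g : ℤ}
    (h : IsLastArgmin (A.potential y i) g) :
    ((i, g) ∈ A.stack y ∧ (i + 1, g) ∉ A.stack y) ∧
      A.potential y i (g + 1) = A.potential y i g + 1 := by
  classical
  have h1 := h.2 (g + 1) (by omega)
  rw [potential_succ A hy] at h1 ⊢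
  split_ifs at h1 ⊢ with h2 h3 h3
  · omega
  · exact ⟨⟨h2, h3⟩, by ring⟩
  · omega
  · omega

theorem isGoodAddable_box {y : ℕ} (hy : 0 < y) (A : Abacus x) (i g : ℤ) :
    IsGoodAddable y (i : ZMod y) A (box y i g) ↔ IsLastArgmin (A.potential y i) g := by
  classical
  rw [IsGoodAddable, isConormal_box hy]
  constructor
  · rintro ⟨⟨h1, h2⟩, h3⟩
    have hg : A.potential y i (g + 1) = A.potential y i g + 1 := by
      rw [potential_succ A hy, if_pos h1.1, if_neg h1.2]; ring
    have hgt : ∀ d > g, A.potential y i g < A.potential y i d := fun d hd => by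
      have := h2 d hd
      omega
    refine ⟨?_, hgt⟩
    by_contra! hc
    obtain ⟨d, hd, hlt⟩ := hc
    -- Take the highest row under `g` with a smaller potential. The walk rises there and stays high,
    -- so this row carries a surviving `A` further right in the word.
    obtain ⟨d, ⟨hd, hlt⟩, hmax⟩ := Int.exists_greatest_of_bdd
      (P := fun d => d ≤ g ∧ A.potential y i d < A.potential y i g)
      ⟨g, fun z hz => hz.1⟩ ⟨d, hd, hlt⟩
    have hdg : d < g := lt_of_le_of_ne hd (by rintro rfl; exact lt_irrefl _ hlt)
    have hge : ∀ d' > d, A.potential y i g ≤ A.potential y i d' := by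
      intro d' hd'
      by_contra! hc
      by_cases hle : d' ≤ g
      · have := hmax d' ⟨hle, hc⟩
        omega
      · have := hgt d' (by omega)
        omega
    have hs := potential_succ A hy i d
    have hge1 := hge (d + 1) (by omega)
    have hL : (i, d) ∈ A.stack y ∧ (i + 1, d) ∉ A.stack y := by
      split_ifs at hs with a b b
      · omega
      · exact ⟨a, b⟩
      · omega
      · omega
    rw [if_pos hL.1, if_neg hL.2] at hs
    rcases h3 (box y i d) ((isConormal_box hy A i d).2 ⟨hL, fun d' hd' => by
      have := hge d' hd'
      omega⟩) with h | h
    · exact hdg.ne (box_injective hy i h)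
    · rw [boxLT_box hy] at h
      omega
  · intro h
    obtain ⟨hL, hg⟩ := h.letter hy
    refine ⟨⟨hL, fun d hd => by have := h.2 d hd; omega⟩, ?_⟩
    intro c hc
    obtain ⟨g', rfl⟩ := exists_eq_box hc.1.1
    rw [isConormal_box hy] at hc
    rw [boxLT_box hy, (box_injective hy i).eq_iff]
    by_contra! hne
    have hlt : g' < g := by omega
    have h1 := hc.2 g (by omega)
    have h2 := h.1 g' (by omega)
    rw [potential_succ A hy, if_pos hc.1.1, if_neg hc.1.2] at h1
    omega

/-- The orbit of a position of the stacked abacus under its translation symmetry. -/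
def SamePosition (x y : ℕ) (c R i g : ℤ) : Prop := ∃ n : ℤ, c = i + y * n ∧ R = g + x * n

theorem crystalArrow_iff {y : ℕ} (hy : 0 < y) (i : ℤ) (A B : Abacus x) :
    CrystalArrow y (i : ZMod y) A B ↔ ∃ g, IsLastArgmin (A.potential y i) g ∧
      ∀ c R, (c, R) ∈ B.stack y ↔ SamePosition x y c R (i + 1) g ∨
        ((c, R) ∈ A.stack y ∧ ¬ SamePosition x y c R i g) := by
  have key : ∀ g, (B.carrier = insert ((box (x := x) y i g).1 + 1, (box (x := x) y i g).2)
      (A.carrier \ {box y i g}) ↔ ∀ c R, (c, R) ∈ B.stack y ↔ SamePosition x y c R (i + 1) g ∨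
        ((c, R) ∈ A.stack y ∧ ¬ SamePosition x y c R i g)) := by
    intro g
    have hpt : ∀ (c : ℤ) (j : Fin x) (m : ℤ),
        ((c - y * m, j) ∈ insert ((box (x := x) y i g).1 + 1, (box (x := x) y i g).2)
          (A.carrier \ {box y i g}) ↔ SamePosition x y c ((j : ℤ) + 1 + x * m) (i + 1) g ∨
        ((c, (j : ℤ) + 1 + x * m) ∈ A.stack y ∧
          ¬ SamePosition x y c ((j : ℤ) + 1 + x * m) i g)) := by
      intro c j m
      rw [Set.mem_insert_iff, Set.mem_sdiff, Set.mem_singleton_iff, box_eq_iff, mem_stack]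
      have : (c - y * m, j) = ((box (x := x) y i g).1 + 1, (box (x := x) y i g).2) ↔
          (c - 1 - y * m, j) = box y i g := by
        rw [Prod.ext_iff, Prod.ext_iff]
        refine and_congr_left fun _ => ?_
        constructor <;> intro h <;> simp only at h ⊢ <;> linarith
      rw [this, box_eq_iff]
      have : (∃ n, c - 1 = i + y * n ∧ (j : ℤ) + 1 + x * m = g + x * n) ↔
          SamePosition x y c ((j : ℤ) + 1 + x * m) (i + 1) g := by
        refine exists_congr fun n => and_congr_left fun _ => ?_
        constructor <;> intro h <;> linarith
      rw [this]
      rfl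
    constructor
    · intro h c R
      obtain ⟨j, m, rfl⟩ := exists_row (x := x) R
      rw [mem_stack, h]
      exact hpt c j m
    · intro h
      ext ⟨c, j⟩
      have := hpt c j 0
      rw [← h, mem_stack] at this
      simpa using this.symm
  constructor
  · rintro ⟨b, hb, hB⟩
    obtain ⟨g, rfl⟩ := exists_eq_box hb.1.1.1
    exact ⟨g, (isGoodAddable_box hy A i g).1 hb, (key g).1 hB⟩
  · rintro ⟨g, hg, hB⟩
    exact ⟨box y i g, (isGoodAddable_box hy A i g).2 hg, (key g).2 hB⟩

end box

/-! ### Moving a bead, and the criterion for sources. -/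

section move

variable {x : ℕ} [NeZero x] {y : ℕ}

/-- A periodic filling of the plane whose rows are black on the left and white on the right is a
stacked abacus. -/
theorem exists_stack_eq (T : Set (ℤ × ℤ))
    (hT : ∀ c R n : ℤ, (c + y * n, R + x * n) ∈ T ↔ (c, R) ∈ T)
    (hl : ∀ R, ∃ M, ∀ c ≤ M, (c, R) ∈ T) (hr : ∀ R, ∃ M, ∀ c ≥ M, (c, R) ∉ T) :
    ∃ B : Abacus x, B.stack y = T := by
  choose l hl using hl
  choose r hr using hr
  obtain ⟨L, hL⟩ := Finset.exists_le (Finset.univ.image fun j : Fin x => -l (j + 1))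
  obtain ⟨U, hU⟩ := Finset.exists_le (Finset.univ.image fun j : Fin x => r (j + 1))
  let B : Abacus x :=
    { carrier := {p | (p.1, (p.2 : ℤ) + 1) ∈ T}
      black_left := ⟨-L, fun β hβ j => hl _ _ (by
        have := hL _ (Finset.mem_image_of_mem _ (Finset.mem_univ j))
        simp only at this ⊢
        linarith)⟩
      white_right := ⟨U, fun β hβ j => hr _ _
        ((hU _ (Finset.mem_image_of_mem _ (Finset.mem_univ j))).trans hβ)⟩ }
  refine ⟨B, Set.ext fun ⟨c, R⟩ => ?_⟩
  obtain ⟨j, m, rfl⟩ := exists_row (x := x) R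
  rw [mem_stack, ← hT c _ (-m)]
  have : (c + y * -m, (j : ℤ) + 1 + x * m + x * -m) = (c - y * m, (j : ℤ) + 1) := by ext <;> ring
  rw [this]
  rfl

omit [NeZero x] in
theorem samePosition_add (c R i g k : ℤ) :
    SamePosition x y (c + k) R (i + k) g ↔ SamePosition x y c R i g := by
  refine exists_congr fun n => and_congr_left fun _ => ?_
  constructor <;> intro h <;> linarith

omit [NeZero x] in
theorem samePosition_periodic (c R i g n : ℤ) :
    SamePosition x y (c + y * n) (R + x * n) i g ↔ SamePosition x y c R i g := by
  constructor
  · rintro ⟨m, h1, h2⟩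
    exact ⟨m - n, by linarith, by linarith⟩
  · rintro ⟨m, rfl, rfl⟩
    exact ⟨m + n, by ring, by ring⟩

theorem SamePosition.eq_of_row {c c' R i i' g : ℤ} (h : SamePosition x y c R i g)
    (h' : SamePosition x y c' R i' g) : c - i = c' - i' := by
  obtain ⟨n, rfl, h1⟩ := h
  obtain ⟨n', rfl, h2⟩ := h'
  have hx : (x : ℤ) ≠ 0 := by exact_mod_cast NeZero.ne x
  have : n = n' := mul_left_cancel₀ hx (by linarith)
  rw [this]; ring

theorem exists_samePosition_bound (R i g : ℤ) :
    ∃ N, ∀ c, SamePosition x y c R i g → c = N := by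
  by_cases h : ∃ N, SamePosition x y N R i g
  · obtain ⟨N, hN⟩ := h
    exact ⟨N, fun c hc => by have := hc.eq_of_row hN; omega⟩
  · exact ⟨0, fun c hc => absurd ⟨c, hc⟩ h⟩

theorem SamePosition.mem_iff {c R i g : ℤ} (h : SamePosition x y c R i g) (A : Abacus x) :
    (c, R) ∈ A.stack y ↔ (i, g) ∈ A.stack y := by
  obtain ⟨n, rfl, rfl⟩ := h
  exact stack_periodic y A i g n

/-- The abacus `B` is obtained from `A` by moving the bead in column `i` and row `g` of the stacked
abacus one step to the right. -/
structure IsMove (y : ℕ) (i g : ℤ) (A B : Abacus x) : Prop where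
  black : (i, g) ∈ A.stack y
  white : (i + 1, g) ∉ A.stack y
  mem_iff : ∀ c R, (c, R) ∈ B.stack y ↔ SamePosition x y c R (i + 1) g ∨
    ((c, R) ∈ A.stack y ∧ ¬ SamePosition x y c R i g)

theorem crystalArrow_iff_isMove (hy : 0 < y) (i : ℤ) (A B : Abacus x) :
    CrystalArrow y (i : ZMod y) A B ↔
      ∃ g, IsLastArgmin (A.potential y i) g ∧ IsMove y i g A B := by
  rw [crystalArrow_iff hy]
  exact exists_congr fun g => and_congr_right fun hg =>
    ⟨fun h => ⟨(hg.letter hy).1.1, (hg.letter hy).1.2, h⟩, fun h => h.mem_iff⟩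

theorem exists_isMove {i g : ℤ} {B : Abacus x} (h1 : (i, g) ∉ B.stack y)
    (h2 : (i + 1, g) ∈ B.stack y) : ∃ A, IsMove y i g A B := by
  have hex : ∃ A : Abacus x, A.stack y = {p | SamePosition x y p.1 p.2 i g ∨
      (p ∈ B.stack y ∧ ¬ SamePosition x y p.1 p.2 (i + 1) g)} := by
    refine exists_stack_eq _ ?_ ?_ ?_
    · intro c R n
      simp only [Set.mem_ofPred_eq, samePosition_periodic, stack_periodic]
    · intro R
      obtain ⟨M, hM⟩ := exists_bound_left y B R
      obtain ⟨N, hN⟩ := exists_samePosition_bound (x := x) (y := y) R (i + 1) g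
      exact ⟨min M (N - 1), fun c hc => Or.inr ⟨hM c (by omega), fun h => by
        have := hN c h; omega⟩⟩
    · intro R
      obtain ⟨M, hM⟩ := exists_bound_right y B R
      obtain ⟨N, hN⟩ := exists_samePosition_bound (x := x) (y := y) R i g
      refine ⟨max M (N + 1), fun c hc => ?_⟩
      rintro (h | h)
      · have := hN c h
        omega
      · exact hM c (by omega) h.1
  obtain ⟨A, hA⟩ := hex
  have hne : ∀ {c R}, SamePosition x y c R i g → ¬ SamePosition x y c R (i + 1) g :=
    fun h h' => by have := h.eq_of_row h'; omega
  have h0 : ∀ k, SamePosition x y k g k g := fun k => ⟨0, by ring, by ring⟩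
  refine ⟨A, ?_, ?_, ?_⟩
  · rw [hA]
    exact Or.inl (h0 i)
  · rw [hA]
    rintro (h | h)
    · exact hne h (h0 _)
    · exact h.2 (h0 _)
  · intro c R
    rw [hA]
    by_cases ha : SamePosition x y c R i g
    · simp only [ha, hne ha, ha.mem_iff B, h1, Set.mem_ofPred_eq]; simp
    · by_cases hb : SamePosition x y c R (i + 1) g
      · simp [hb, hb.mem_iff B, h2]
      · simp [ha, hb]

-- A white position appears in column `i` and one disappears in column `i + 1`, so the count to the
-- left changes only at column `i + 1`.
open Classical in
theorem isMove_iff_height {i g : ℤ} {A B : Abacus x} (h1 : (i, g) ∈ A.stack y)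
    (h2 : (i + 1, g) ∉ A.stack y) : IsMove y i g A B ↔ ∀ c R, B.height y c R =
      A.height y c R + if SamePosition x y c R (i + 1) g then 1 else 0 := by
  have hne : ∀ {c R}, SamePosition x y c R i g → ¬ SamePosition x y c R (i + 1) g :=
    fun h h' => by have := h.eq_of_row h'; omega
  have hadd : ∀ {c R}, SamePosition x y (c + 1) R (i + 1) g ↔ SamePosition x y c R i g :=
    samePosition_add ..
  constructor
  · intro h c R
    refine height_eq_of_increments (f := fun c =>
      A.height y c R + if SamePosition x y c R (i + 1) g then 1 else 0) y ?_ ?_ ?_ c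
    · obtain ⟨M, hM⟩ := exists_height_eq_zero y A R
      obtain ⟨N, hN⟩ := exists_samePosition_bound (x := x) (y := y) R (i + 1) g
      refine ⟨min M (N - 1), fun c hc => ?_⟩
      rw [hM c (by omega), if_neg, add_zero]
      intro h
      have := hN c h
      omega
    · intro c hc
      simp only [hadd]
      rcases (h.mem_iff c R).1 hc with h' | h'
      · have : (c, R) ∉ A.stack y := by rwa [h'.mem_iff]
        rw [height_succ_of_notMem y A this, if_pos h', if_neg fun h'' => hne h'' h']
        ring
      · have : ¬ SamePosition x y c R (i + 1) g := fun h'' => h2 ((h''.mem_iff A).1 h'.1)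
        rw [height_succ_of_mem y A h'.1, if_neg h'.2, if_neg this]
    · intro c hc
      simp only [hadd]
      rw [h.mem_iff, not_or, not_and_not_right] at hc
      rw [if_neg hc.1]
      by_cases h' : SamePosition x y c R i g
      · rw [if_pos h', height_succ_of_mem y A ((h'.mem_iff A).2 h1)]; ring
      · rw [if_neg h', height_succ_of_notMem y A fun h'' => h' (hc.2 h'')]; ring
  · intro h
    refine ⟨h1, h2, fun c R => ?_⟩
    rw [mem_stack_iff_height, h, h]
    simp only [hadd]
    by_cases ha : SamePosition x y c R i g
    · have := height_succ_of_mem y A ((ha.mem_iff A).2 h1)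
      simp [ha, hne ha, this]
    · by_cases hb : SamePosition x y c R (i + 1) g
      · have := height_succ_of_notMem y A (show (c, R) ∉ A.stack y by rwa [hb.mem_iff])
        simp [ha, hb, this]
      · simp [ha, hb, mem_stack_iff_height]

/-- The letter at row `g` turns from `A` to `R`, so the step `+1` of the walk becomes `-1`. Since `1
< y`, columns `i` and `i + 1` have distinct residues and no other row is affected. -/
theorem IsMove.potential_eq (hy : 1 < y) {i g : ℤ} {A B : Abacus x} (h : IsMove y i g A B) (r : ℤ) :
    B.potential y i r = A.potential y i r - if g < r then 2 else 0 := by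
  classical
  have hx : (x : ℤ) ≠ 0 := by exact_mod_cast NeZero.ne x
  have hy0 : 0 < y := by omega
  have hy' : (1 : ℤ) < y := by exact_mod_cast hy
  have a1 : ∀ k r, SamePosition x y k r k g ↔ r = g := by
    intro k r
    constructor
    · rintro ⟨n, h3, rfl⟩
      have : (y : ℤ) * n = 0 := by linarith
      rcases mul_eq_zero.1 this with h0 | rfl
      · omega
      · ring
    · rintro rfl
      exact ⟨0, by ring, by ring⟩
  have hdvd : ¬ (y : ℤ) ∣ 1 := fun hd => by
    have := Int.le_of_dvd one_pos hd
    omega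
  have a2 : ∀ r, ¬ SamePosition x y i r (i + 1) g := by
    rintro r ⟨n, h3, -⟩
    exact hdvd ⟨-n, by linarith⟩
  have a3 : ∀ r, ¬ SamePosition x y (i + 1) r i g := by
    rintro r ⟨n, h3, -⟩
    exact hdvd ⟨n, by linarith⟩
  refine congrFun (eq_of_increments (f := B.potential y i)
    (g := fun r => A.potential y i r - if g < r then 2 else 0) ?_ ?_ ?_) r
  · exact min g (min (exists_potential_eq_zero B hy0 i).choose
      (exists_potential_eq_zero A hy0 i).choose)
  · rw [(exists_potential_eq_zero B hy0 i).choose_spec _ (by omega),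
      (exists_potential_eq_zero A hy0 i).choose_spec _ (by omega), if_neg (by omega), sub_zero]
  · intro n
    rw [potential_succ B hy0, potential_succ A hy0]
    simp only [h.mem_iff, a1, a2, a3]
    by_cases hn : n = g
    · subst hn
      simp only [h.black, h.white]
      simp
      ring
    · have : g < n + 1 ↔ g < n := by omega
      simp only [hn, this, not_false_eq_true, and_true, false_or]
      ring

/-- A negative minimum is first reached just after a removable box. Undoing that box adds 2 to the
walk beyond it and makes it the last minimum of the preimage, so an arrow enters. Conversely, an
arrow acts at a minimum, which is at most 0, and leaves a value at most `-1` behind. -/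
theorem isSource_iff (hy : 1 < y) (A : Abacus x) :
    IsSource y A ↔ ∀ i r : ℤ, 0 ≤ A.potential y i r := by
  have hy0 : 0 < y := by omega
  constructor
  · intro hs i
    by_contra! hc
    obtain ⟨r, hr⟩ := hc
    obtain ⟨M, hM⟩ := exists_potential_eq_zero A hy0 i
    obtain ⟨N, hN⟩ := exists_potential_const A hy0 i
    have hbdd : ∃ b, ∀ v, (∃ r, A.potential y i r = v) → b ≤ v := by
      have hfin : ((Finset.Icc M N).image (A.potential y i) : Set ℤ).Finite :=
        Finset.finite_toSet _
      obtain ⟨b, hb⟩ := hfin.bddBelow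
      refine ⟨min b (min 0 (A.potential y i N)), ?_⟩
      rintro _ ⟨s, rfl⟩
      rcases le_total s M with h | h
      · rw [hM s h]; omega
      · rcases le_total N s with h' | h'
        · rw [hN s h']; omega
        · have := hb (Finset.mem_coe.2 (Finset.mem_image_of_mem _ (Finset.mem_Icc.2 ⟨h, h'⟩)))
          omega
    obtain ⟨v, ⟨r, rfl⟩, hv⟩ := Int.exists_least_of_bdd (P := fun v => ∃ r, A.potential y i r = v)
      hbdd ⟨_, r, rfl⟩
    have hneg : A.potential y i r < 0 := lt_of_le_of_lt (hv _ ⟨_, rfl⟩) hr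
    obtain ⟨s, hs1, hs2⟩ := Int.exists_least_of_bdd
      (P := fun s => A.potential y i s = A.potential y i r)
      ⟨M, fun z hz => le_of_not_ge fun h => by have := hM z h; omega⟩ ⟨r, rfl⟩
    rw [← hs1] at hv hneg
    have hlt : ∀ d < s, A.potential y i s < A.potential y i d := fun d hd =>
      lt_of_le_of_ne (hv _ ⟨d, rfl⟩) fun h => by
        have := hs2 d (by rw [← h, hs1])
        omega
    obtain ⟨g, rfl⟩ : ∃ g, s = g + 1 := ⟨s - 1, by ring⟩
    have h1 := hlt g (by omega)
    classical
    have h2 := potential_succ A hy0 i g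
    obtain ⟨B, hB⟩ := exists_isMove (y := y) (i := i) (g := g) (B := A)
      (fun h => by rw [if_pos h] at h2; split_ifs at h2 <;> omega)
      (by by_contra h; rw [if_neg h] at h2; split_ifs at h2 <;> omega)
    refine hs i B ((crystalArrow_iff_isMove hy0 i B A).2 ⟨g, ?_, hB⟩)
    have h3 : A.potential y i (g + 1) + 1 = A.potential y i g := by
      split_ifs at h2 <;> omega
    have hp := hB.potential_eq hy
    have e0 := hp g
    rw [if_neg (lt_irrefl g)] at e0
    constructor
    · intro d hd
      have e1 := hp d
      rw [if_neg (by omega)] at e1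
      have := hlt d (by omega)
      omega
    · intro d hd
      have e1 := hp d
      rw [if_pos hd] at e1
      have := hv _ ⟨d, rfl⟩
      omega
  · intro h i B hB
    obtain ⟨i, rfl⟩ := ZMod.intCast_surjective i
    obtain ⟨g, hg, hm⟩ := (crystalArrow_iff_isMove hy0 i B A).1 hB
    have h1 := hm.potential_eq hy (g + 1)
    rw [if_pos (by omega), (hg.letter hy0).2] at h1
    obtain ⟨M, hM⟩ := exists_potential_eq_zero B hy0 i
    have h2 := hg.1 (min M g) (by omega)
    rw [hM (min M g) (by omega)] at h2
    have := h i (g + 1)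
    omega

end move

/-! ### Sources in the dual as a condition on heights. -/

/-- The heights weakly decrease from each row of the stacked abacus to the next one. -/
def HasCylindricHeight (e : ℕ) {ℓ : ℕ} (A : Abacus ℓ) : Prop :=
  ∀ c R, A.height e c (R + 1) ≤ A.height e c R

theorem isSource_dual_iff {ℓ e : ℕ} [NeZero ℓ] [NeZero e] (hℓ : 1 < ℓ) (A : Abacus ℓ) :
    (A.dual e).IsSource ℓ ↔ A.HasCylindricHeight e := by
  rw [isSource_iff hℓ]
  simp only [potential, depth_dual, sub_nonneg]
  constructor
  · intro h c R
    simpa using h R (c + e)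
  · intro h i r
    exact h _ _

/-! ### Beads, parts and heights of a single row. -/

section row

variable {x : ℕ} (A : Abacus x) (j : Fin x)

/-- The number of white positions left of column `γ` in row `j`. -/
noncomputable def rowHeight (γ : ℤ) : ℤ := below {β | (β, j) ∉ A.carrier} γ

/-- The number of beads weakly to the right of column `γ` in row `j`. -/
noncomputable def rowCount (γ : ℤ) : ℕ := {β : ℤ | γ ≤ β ∧ (β, j) ∈ A.carrier}.ncard

theorem rowCount_finite (γ : ℤ) : {β : ℤ | γ ≤ β ∧ (β, j) ∈ A.carrier}.Finite := by
  obtain ⟨M, hM⟩ := A.white_right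
  exact (Set.finite_Icc γ M).subset fun β hβ =>
    ⟨hβ.1, le_of_not_ge fun h => hM β h j hβ.2⟩

theorem rowCount_of_mem {γ : ℤ} (h : (γ, j) ∈ A.carrier) :
    A.rowCount j γ = A.rowCount j (γ + 1) + 1 := by
  have : {β : ℤ | γ ≤ β ∧ (β, j) ∈ A.carrier} =
      insert γ {β : ℤ | γ + 1 ≤ β ∧ (β, j) ∈ A.carrier} := by
    ext β
    simp only [Set.mem_ofPred_eq, Set.mem_insert_iff, le_iff_eq_or_lt (a := γ), ← Int.add_one_le_iff (a := γ)]
    constructor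
    · rintro ⟨rfl | h1, h2⟩
      exacts [Or.inl rfl, Or.inr ⟨h1, h2⟩]
    · rintro (rfl | ⟨h1, h2⟩)
      exacts [⟨Or.inl rfl, h⟩, ⟨Or.inr h1, h2⟩]
  rw [rowCount, this, Set.ncard_insert_of_notMem (fun h => by have := h.1; omega)
    (rowCount_finite A j _)]
  rfl

theorem rowCount_of_notMem {γ : ℤ} (h : (γ, j) ∉ A.carrier) :
    A.rowCount j γ = A.rowCount j (γ + 1) := by
  unfold rowCount
  congr 1
  ext β
  simp only [Set.mem_ofPred_eq, le_iff_eq_or_lt (a := γ), ← Int.add_one_le_iff (a := γ)]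
  constructor
  · rintro ⟨rfl | h1, h2⟩
    exacts [absurd h2 h, ⟨h1, h2⟩]
  · rintro ⟨h1, h2⟩
    exact ⟨Or.inr h1, h2⟩

theorem rowCount_antitone : Antitone (A.rowCount j) := by
  intro γ γ' h
  exact Set.ncard_le_ncard (fun β hβ => ⟨h.trans hβ.1, hβ.2⟩) (rowCount_finite A j γ)

theorem rowHeight_mono : Monotone (A.rowHeight j) := by
  intro γ γ' h
  obtain ⟨M, hM⟩ := A.black_left
  unfold rowHeight below
  have hb : BddBelow {β | (β, j) ∉ A.carrier} :=
    ⟨M, fun k hk => le_of_not_ge fun h => hk (hM k h j)⟩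
  exact_mod_cast Set.ncard_le_ncard
    (Set.inter_subset_inter_right _ (Set.Iio_subset_Iio h)) (finite_inter_Iio hb γ')

/-- At `γ = 1` this is the definition of the charge. One step to the right lowers the left side by
one, whatever the colour of the position. -/
theorem rowCount_sub_rowHeight (γ : ℤ) :
    (A.rowCount j γ : ℤ) - A.rowHeight j γ = A.charge j - γ + 1 := by
  obtain ⟨M, hM⟩ := A.black_left
  have hb : BddBelow {β | (β, j) ∉ A.carrier} :=
    ⟨M, fun k hk => le_of_not_ge fun h => hk (hM k h j)⟩
  refine congrFun (eq_of_increments (f := fun γ => (A.rowCount j γ : ℤ) - A.rowHeight j γ)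
    (g := fun γ => A.charge j - γ + 1) 1 ?_ fun n => ?_) γ
  · have h1 : {β : ℤ | (1 : ℤ) ≤ β ∧ (β, j) ∈ A.carrier} =
        {β : ℤ | 0 < β ∧ (β, j) ∈ A.carrier} := rfl
    have h2 : {β | (β, j) ∉ A.carrier} ∩ Set.Iio 1 =
        {β : ℤ | β ≤ 0 ∧ (β, j) ∉ A.carrier} := by
      ext β
      simp only [Set.mem_inter_iff, Set.mem_ofPred_eq, Set.mem_Iio]
      rw [and_comm, show β < 1 ↔ β ≤ 0 by omega]
    simp only [rowCount, rowHeight, below, charge, h1, h2]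
    ring
  · simp only [rowHeight]
    by_cases h : (n, j) ∈ A.carrier
    · rw [below_succ_of_notMem (by simpa using h), rowCount_of_mem A j h]
      push_cast
      ring
    · rw [below_succ_of_mem hb (by simpa using h), rowCount_of_notMem A j h]
      ring

theorem exists_rowCount_eq_zero : ∃ M, ∀ γ ≥ M, A.rowCount j γ = 0 := by
  obtain ⟨M, hM⟩ := A.white_right
  refine ⟨M, fun γ hγ => ?_⟩
  have : {β : ℤ | γ ≤ β ∧ (β, j) ∈ A.carrier} = ∅ :=
    Set.eq_empty_of_forall_notMem fun β hβ => hM β (hγ.trans hβ.1) j hβ.2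
  rw [rowCount, this, Set.ncard_empty]

theorem bead_spec {k : ℕ} (hk : 1 ≤ k) :
    (A.bead j k, j) ∈ A.carrier ∧ A.rowCount j (A.bead j k) = k := by
  obtain ⟨M, hM⟩ := exists_rowCount_eq_zero A j
  obtain ⟨β, hβ, hmax⟩ := Int.exists_greatest_of_bdd (P := fun β => k ≤ A.rowCount j β)
    ⟨M, fun z hz => le_of_not_ge fun h => by rw [hM z h] at hz; omega⟩
    -- At this column the charge identity makes the count equal to `k` plus a height, hence at least
    -- `k`.
    ⟨A.charge j + 1 - k, by
      have h1 := rowCount_sub_rowHeight A j (A.charge j + 1 - k)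
      have h2 : 0 ≤ A.rowHeight j (A.charge j + 1 - k) := below_nonneg _ _
      omega⟩
  have hlt : A.rowCount j (β + 1) < k := by
    by_contra! h
    have := hmax _ h
    omega
  have hmem : (β, j) ∈ A.carrier := by
    by_contra h
    rw [rowCount_of_notMem A j h] at hβ
    omega
  have : A.bead j k = β := IsGreatest.csSup_eq ⟨⟨hmem, hβ⟩, fun γ hγ => hmax γ hγ.2⟩
  rw [this]
  refine ⟨hmem, ?_⟩
  have := rowCount_of_mem A j hmem
  omega

variable {j} in
theorem bead_rowCount {β : ℤ} (h : (β, j) ∈ A.carrier) : A.bead j (A.rowCount j β) = β := by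
  have h1 := rowCount_of_mem A j h
  obtain ⟨h2, h3⟩ := bead_spec A j (k := A.rowCount j β) (by omega)
  have h4 := rowCount_of_mem A j h2
  rcases lt_trichotomy (A.bead j (A.rowCount j β)) β with h5 | h5 | h5
  · have := rowCount_antitone A j (show A.bead j (A.rowCount j β) + 1 ≤ β by omega)
    omega
  · exact h5
  · have := rowCount_antitone A j (show β + 1 ≤ A.bead j (A.rowCount j β) by omega)
    omega

theorem part_eq {k : ℕ} (hk : 1 ≤ k) : A.part j k = A.rowHeight j (A.bead j k) := by
  have h1 := (bead_spec A j hk).2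
  have h2 := rowCount_sub_rowHeight A j (A.bead j k)
  rw [part]
  omega

/-- Comparison of the parts of two rows in terms of their heights. -/
theorem part_le_part_iff (i j : Fin x) (d : ℤ) :
    (A.charge i ≤ A.charge j + d ∧ ∀ k k' : ℕ, 1 ≤ k →
      (k' : ℤ) = k + (A.charge j + d - A.charge i) → A.part j k' ≤ A.part i k) ↔
    ∀ γ, A.rowHeight j (γ - d) ≤ A.rowHeight i γ := by
  constructor
  · rintro ⟨h1, h2⟩ γ
    by_contra! hc
    have e1 := rowCount_sub_rowHeight A i γ
    have e2 := rowCount_sub_rowHeight A j (γ - d)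
    -- With this `k` the `k`-th bead of row `i` is the first one left of `γ`. The matching `k'` is
    -- at most the count of row `j` at `γ - d`, so that bead lies weakly right of `γ - d` and its
    -- part is too large.
    have hk : 1 ≤ A.rowCount i γ + 1 := by omega
    obtain ⟨k', hk'⟩ := Int.eq_ofNat_of_zero_le
      (show 0 ≤ ((A.rowCount i γ + 1 : ℕ) : ℤ) + (A.charge j + d - A.charge i) by omega)
    have h3 := h2 (A.rowCount i γ + 1) k' hk hk'.symm
    have hk1 : 1 ≤ k' := by omega
    rw [part_eq A j hk1, part_eq A i hk] at h3
    obtain ⟨b1, b2⟩ := bead_spec A i hk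
    obtain ⟨b3, b4⟩ := bead_spec A j hk1
    have h4 : A.bead i (A.rowCount i γ + 1) ≤ γ := by
      by_contra! h
      have := rowCount_antitone A i h.le
      omega
    have h5 : γ - d ≤ A.bead j k' := by
      by_contra! h
      have := rowCount_antitone A j (show A.bead j k' + 1 ≤ γ - d by omega)
      have := rowCount_of_mem A j b3
      push_cast at hk'
      omega
    have := rowHeight_mono A i h4
    have := rowHeight_mono A j h5
    omega
  · intro h
    refine ⟨?_, fun k k' hk hk' => ?_⟩
    -- To the right of all beads both counts vanish, and the height inequality becomes the
    -- inequality of charges.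
    · obtain ⟨M, hM⟩ := exists_rowCount_eq_zero A i
      obtain ⟨N, hN⟩ := exists_rowCount_eq_zero A j
      have h1 := h (max M (N + d))
      have e1 := rowCount_sub_rowHeight A i (max M (N + d))
      have e2 := rowCount_sub_rowHeight A j (max M (N + d) - d)
      rw [hM _ (by omega)] at e1
      rw [hN _ (by omega)] at e2
      omega
    · obtain ⟨b1, b2⟩ := bead_spec A i hk
      have e1 := rowCount_sub_rowHeight A i (A.bead i k + 1)
      have e2 := rowCount_sub_rowHeight A j (A.bead i k + 1 - d)
      have h1 := h (A.bead i k + 1)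
      have h2 := rowCount_of_mem A i b1
      -- Just past the `k`-th bead of row `i` its count is `k - 1`, so the count of row `j` there is
      -- at most `k' - 1`. This excludes `k' = 0` and bounds the `k'`-th bead.
      rcases Nat.eq_zero_or_pos k' with rfl | hk1
      · omega
      · obtain ⟨b3, b4⟩ := bead_spec A j hk1
        have h3 : A.bead j k' + d ≤ A.bead i k := by
          by_contra! hc
          have := rowCount_antitone A j (show A.bead i k + 1 - d ≤ A.bead j k' by omega)
          omega
        rw [part, part]
        omega

end row

theorem height_row {x : ℕ} (y : ℕ) (A : Abacus x) (c : ℤ) (j : Fin x) (m : ℤ) :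
    A.height y c ((j : ℤ) + 1 + x * m) = A.rowHeight j (c - y * m) := by
  unfold height rowHeight
  rw [sub_eq_add_neg, ← below_shift]
  congr 1
  ext γ
  simp only [Set.mem_ofPred_eq, mem_stack, sub_eq_add_neg]

/-- In the stack, row `ℓ` is followed by row 1 shifted by `e`. The ordinary conditions (shift `d =
0`) and the wrap-around one (`d = e`) thus become one condition on consecutive rows. -/
theorem isCylindric_iff {ℓ e : ℕ} [NeZero ℓ] (A : Abacus ℓ) :
    A.IsCylindric e ↔ A.HasCylindricHeight e := by
  constructor
  · rintro ⟨⟨-, h1, h2⟩, h3, h4⟩ c R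
    obtain ⟨j, m, rfl⟩ := exists_row (x := ℓ) R
    by_cases hj : (j : ℕ) + 1 < ℓ
    · have e1 : (j : ℤ) + 1 + ℓ * m + 1 = ((⟨j + 1, hj⟩ : Fin ℓ) : ℤ) + 1 + ℓ * m := by
        push_cast; ring
      rw [e1, height_row, height_row]
      have := (part_le_part_iff A j ⟨j + 1, hj⟩ 0).1
        ⟨by simpa using h1 j ⟨j + 1, hj⟩ (Fin.le_def.2 (Nat.le_succ _)), fun k k' hk hk' =>
          h3 j ⟨j + 1, hj⟩ rfl k k' hk (by linarith)⟩ (c - e * m)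
      simpa using this
    · have hj' : (j : ℕ) + 1 = ℓ := by have := j.2; omega
      have hj'' : (j : ℤ) + 1 = ℓ := by exact_mod_cast hj'
      have e1 : (j : ℤ) + 1 + ℓ * m + 1 =
          ((⟨0, NeZero.pos ℓ⟩ : Fin ℓ) : ℤ) + 1 + ℓ * (m + 1) := by
        rw [hj'']; push_cast; ring
      rw [e1, height_row, height_row]
      have := (part_le_part_iff A j ⟨0, NeZero.pos ℓ⟩ e).1
        ⟨h2 _ _ rfl hj', fun k k' hk hk' =>
          h4 ⟨0, NeZero.pos ℓ⟩ j rfl hj' k k' hk (by linarith)⟩ (c - e * m)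
      have e2 : c - e * (m + 1) = c - e * m - e := by ring
      rwa [e2]
  · intro h
    have hc : ∀ i j : Fin ℓ, (j : ℕ) = i + 1 →
        ∀ γ, A.rowHeight j (γ - 0) ≤ A.rowHeight i γ := by
      intro i j hij γ
      have := h γ ((i : ℤ) + 1 + ℓ * 0)
      have e1 : (i : ℤ) + 1 + ℓ * 0 + 1 = (j : ℤ) + 1 + ℓ * 0 := by rw [hij]; push_cast; ring
      rw [e1, height_row, height_row] at this
      simpa using this
    have hl : ∀ i j : Fin ℓ, (i : ℕ) = 0 → (j : ℕ) + 1 = ℓ →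
        ∀ γ, A.rowHeight i (γ - e) ≤ A.rowHeight j γ := by
      intro i j hi hj γ
      have := h γ ((j : ℤ) + 1 + ℓ * 0)
      have hj'' : (j : ℤ) + 1 = ℓ := by exact_mod_cast hj
      have e1 : (j : ℤ) + 1 + ℓ * 0 + 1 = (i : ℤ) + 1 + ℓ * 1 := by
        rw [hi, hj'']; push_cast; ring
      rw [e1, height_row, height_row] at this
      simpa using this
    refine ⟨⟨rfl, ?_, ?_⟩, ?_, ?_⟩
    · have : ∀ (n : ℕ) (i j : Fin ℓ), (j : ℕ) = i + n → A.charge i ≤ A.charge j := by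
        intro n
        induction n with
        | zero => intro i j hij; rw [Fin.ext (show (i : ℕ) = j by omega)]
        | succ n ih =>
          intro i j hij
          have hlt : (i : ℕ) + n < ℓ := by have := j.2; omega
          have h1 := ih i ⟨i + n, hlt⟩ rfl
          have h2 := ((part_le_part_iff A ⟨i + n, hlt⟩ j 0).2 (hc _ _ (by simp only; omega))).1
          linarith
      intro i j hij
      exact this (j - i) i j (by have := Fin.le_def.1 hij; omega)
    · intro i j hi hj
      exact ((part_le_part_iff A j i e).2 (hl i j hi hj)).1
    · intro i j hij k k' hk hk'
      exact ((part_le_part_iff A i j 0).2 (hc i j hij)).2 k k' hk (by linarith)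
    · intro i j hi hj k k' hk hk'
      exact ((part_le_part_iff A j i e).2 (hl i j hi hj)).2 k k' hk (by linarith)

/-! ### Full heights and the FLOTW condition. -/

/-- Every column of the stacked abacus contains a bead of height `a`. -/
def IsFull (e : ℕ) {ℓ : ℕ} (A : Abacus ℓ) (a : ℤ) : Prop :=
  ∀ c, ∃ R, (c, R) ∈ A.stack e ∧ A.height e c R = a

/-- The number `λ - k + s` is the column of the bead minus one, and the part is the height of the
bead. A column of the stack collects all abacus columns of one residue. -/
theorem residues_eq_univ_iff {ℓ e : ℕ} [NeZero ℓ] (A : Abacus ℓ) (a : ℤ) :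
    A.residues e a = Set.univ ↔ A.IsFull e a := by
  constructor
  · intro h c
    obtain ⟨j, k, hk, h1, h2⟩ : ((c - 1 : ℤ) : ZMod e) ∈ A.residues e a := h ▸ Set.mem_univ _
    have h3 : A.part j k - k + A.charge j = A.bead j k - 1 := by rw [part]; ring
    rw [h3, ZMod.intCast_eq_intCast_iff_dvd_sub] at h2
    obtain ⟨m, hm⟩ := h2
    have h4 : c - e * m = A.bead j k := by linarith
    refine ⟨(j : ℤ) + 1 + ℓ * m, ?_, ?_⟩
    · rw [mem_stack, h4]
      exact (bead_spec A j hk).1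
    · rw [height_row, h4, ← part_eq A j hk, h1]
  · intro h
    refine Set.eq_univ_of_forall fun r => ?_
    obtain ⟨c, rfl⟩ := ZMod.intCast_surjective r
    obtain ⟨R, h1, h2⟩ := h (c + 1)
    obtain ⟨j, m, rfl⟩ := exists_row (x := ℓ) R
    rw [mem_stack] at h1
    rw [height_row] at h2
    have hk : 1 ≤ A.rowCount j (c + 1 - e * m) := by
      rw [rowCount_of_mem A j h1]; omega
    refine ⟨j, A.rowCount j (c + 1 - e * m), hk, ?_, ?_⟩
    · rw [part_eq A j hk, bead_rowCount A h1, h2]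
    · have h3 : A.part j (A.rowCount j (c + 1 - e * m)) - A.rowCount j (c + 1 - e * m) +
          A.charge j = c - e * m := by
        rw [part, bead_rowCount A h1]; ring
      rw [h3]
      simp

theorem isFLOTW_iff {ℓ e : ℕ} [NeZero ℓ] (A : Abacus ℓ) :
    A.IsFLOTW e ↔ A.HasCylindricHeight e ∧ ∀ a > 0, ¬ A.IsFull e a := by
  rw [IsFLOTW, isCylindric_iff]
  simp only [ne_eq, residues_eq_univ_iff, gt_iff_lt]

/-! ### Level curves of a cylindric abacus. -/

section level

variable {ℓ e : ℕ} [NeZero ℓ]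

theorem exists_le_height (A : Abacus ℓ) (R n : ℤ) : ∃ M, ∀ c ≥ M, n ≤ A.height e c R := by
  obtain ⟨M, hM⟩ := exists_bound_right e A R
  have key : ∀ c ≥ M, c - M ≤ A.height e c R := by
    intro c hc
    induction c, hc using Int.leInduction with
    | base => rw [sub_self]; exact height_nonneg ..
    | succ c hc ih => rw [height_succ_of_notMem e A (hM c hc)]; linarith
  exact ⟨max M (M + n), fun c hc => by have := key c (by omega); omega⟩

/-- The first row of the stacked abacus in which the height at column `c` is smaller than `a`. -/
noncomputable def level (e : ℕ) (A : Abacus ℓ) (a c : ℤ) : ℤ := sInf {R | A.height e c R < a}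

omit [NeZero ℓ] in
theorem HasCylindricHeight.antitone {A : Abacus ℓ} (hA : A.HasCylindricHeight e) (c : ℤ) :
    Antitone (A.height e c) :=
  antitone_int_of_succ_le fun R => hA c R

variable [NeZero e] {A B C : Abacus ℓ}

/-- By periodicity, heights in a column are large far down and zero far up. The set defining `level`
is thus nonempty (as `0 < a`) and bounded below, so its infimum is attained. -/
theorem lt_level_iff (hA : A.HasCylindricHeight e) {a : ℤ} (ha : 0 < a) (c R : ℤ) :
    R < A.level e a c ↔ a ≤ A.height e c R := by
  have he : (1 : ℤ) ≤ e := by exact_mod_cast NeZero.pos e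
  have hbdd : BddBelow {R | A.height e c R < a} := by
    obtain ⟨M, hM⟩ := exists_le_height (e := e) A 0 a
    refine ⟨-ℓ * (|M| + |c|), fun R hR => ?_⟩
    by_contra! hlt
    have h1 := hA.antitone c hlt.le
    have h2 := height_periodic e A c (-ℓ * (|M| + |c|)) (|M| + |c|)
    rw [show -(ℓ : ℤ) * (|M| + |c|) + ℓ * (|M| + |c|) = 0 by ring] at h2
    have h3 := hM (c + e * (|M| + |c|)) (by
      have := le_abs_self M
      have := neg_abs_le c
      nlinarith [abs_nonneg M, abs_nonneg c])
    have : A.height e c R < a := hR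
    omega
  have hne : {R | A.height e c R < a}.Nonempty := by
    obtain ⟨M, hM⟩ := exists_height_eq_zero e A 0
    refine ⟨ℓ * (|M| + |c|), ?_⟩
    have h2 := height_periodic e A (c - e * (|M| + |c|)) 0 (|M| + |c|)
    rw [sub_add_cancel, zero_add] at h2
    rw [Set.mem_ofPred_eq, h2, hM]
    · exact ha
    · have := neg_abs_le M
      have := le_abs_self c
      nlinarith [abs_nonneg M, abs_nonneg c]
  have hmem : A.height e c (A.level e a c) < a := Int.csInf_mem hne hbdd
  constructor
  · intro h
    by_contra! h'
    have : A.level e a c ≤ R := csInf_le hbdd h'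
    omega
  · intro h
    by_contra! h'
    have := hA.antitone c h'
    omega

theorem level_le_level_succ (hA : A.HasCylindricHeight e) {a : ℤ} (ha : 0 < a) (c : ℤ) :
    A.level e a c ≤ A.level e a (c + 1) := by
  by_contra! h
  rw [lt_level_iff hA ha] at h
  have := height_mono e A (show c ≤ c + 1 by omega) (A.level e a (c + 1))
  have := lt_level_iff hA ha (c + 1) (A.level e a (c + 1))
  omega

theorem level_antitone (hA : A.HasCylindricHeight e) {a b : ℤ} (ha : 0 < a) (hab : a ≤ b)
    (c : ℤ) : A.level e b c ≤ A.level e a c := by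
  by_contra! h
  rw [lt_level_iff hA (by omega)] at h
  have := lt_level_iff hA ha c (A.level e a c)
  omega

theorem level_succ_succ_le (hA : A.HasCylindricHeight e) {a : ℤ} (ha : 0 < a) (c : ℤ) :
    A.level e (a + 1) (c + 1) ≤ A.level e a c := by
  by_contra! h
  rw [lt_level_iff hA (by omega)] at h
  have := lt_level_iff hA ha c (A.level e a c)
  have := height_succ_cases e A c (A.level e a c)
  omega

theorem level_periodic (hA : A.HasCylindricHeight e) {a : ℤ} (ha : 0 < a) (c n : ℤ) :
    A.level e a (c + e * n) = A.level e a c + ℓ * n := by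
  have key : ∀ R, R + ℓ * n < A.level e a (c + e * n) ↔ R < A.level e a c := fun R => by
    rw [lt_level_iff hA ha, lt_level_iff hA ha, height_periodic]
  have h1 := key (A.level e a c)
  have h2 := key (A.level e a (c + e * n) - ℓ * n)
  omega

/-- A bead is a position where the heights at `c` and `c + 1` agree. The beads of a given height in
a column form an interval of rows, here called a gap. -/
theorem mem_and_height_eq_iff (hA : A.HasCylindricHeight e) {a : ℤ} (ha : 0 < a) (c R : ℤ) :
    (c, R) ∈ A.stack e ∧ A.height e c R = a ↔
      A.level e (a + 1) (c + 1) ≤ R ∧ R < A.level e a c := by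
  rw [lt_level_iff hA ha, ← not_lt, lt_level_iff hA (by omega), mem_stack_iff_height]
  have := height_succ_cases e A c R
  omega

theorem isFull_iff (hA : A.HasCylindricHeight e) {a : ℤ} (ha : 0 < a) :
    A.IsFull e a ↔ ∀ c, A.level e (a + 1) (c + 1) < A.level e a c := by
  simp only [IsFull, mem_and_height_eq_iff hA ha]
  exact forall_congr' fun c => ⟨fun ⟨R, h1, h2⟩ => by omega, fun h => ⟨_, le_rfl, h⟩⟩

/-! ### The potential at the levels -/

/-- The value of the potential of colour `i` at the `a`-th level. -/
noncomputable def levelPotential (e : ℕ) (A : Abacus ℓ) (i a : ℤ) : ℤ :=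
  A.potential e i (A.level e a (i + 1))

/-- In these rows column `i + 1` has height `a`. So column `i` is black exactly below level `a`, and
column `i + 1` is black exactly from level `a + 1` at `i + 2` upwards. The slopes of the walk are 1,
0, -1 in this order, and its minimum is at an end. -/
theorem potential_between (hA : A.HasCylindricHeight e) {a : ℤ} (ha : 0 < a) (i : ℤ) {r : ℤ}
    (h1 : A.level e (a + 1) (i + 1) ≤ r) (h2 : r ≤ A.level e a (i + 1)) :
    A.potential e i r = A.levelPotential e i (a + 1) +
      (min r (A.level e a i) - A.level e (a + 1) (i + 1)) -
      (max r (A.level e (a + 1) (i + 1 + 1)) - A.level e (a + 1) (i + 1 + 1)) := by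
  classical
  induction r, h1 using Int.leInduction with
  | base =>
    have := level_succ_succ_le hA ha i
    have := level_le_level_succ hA (show 0 < a + 1 by omega) (i + 1)
    rw [levelPotential]
    omega
  | succ r h1 ih =>
    have ih := ih (by omega)
    have e1 : A.height e (i + 1) r = a := by
      have := lt_level_iff hA ha (i + 1) r
      have := lt_level_iff hA (show 0 < a + 1 by omega) (i + 1) r
      omega
    have e2 : (i, r) ∈ A.stack e ↔ r < A.level e a i := by
      rw [mem_stack_iff_height, lt_level_iff hA ha]
      have := height_succ_cases e A i r
      omega
    have e3 : (i + 1, r) ∈ A.stack e ↔ A.level e (a + 1) (i + 1 + 1) ≤ r := by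
      rw [mem_stack_iff_height, ← not_lt, lt_level_iff hA (by omega)]
      have := height_succ_cases e A (i + 1) r
      omega
    rw [potential_succ A (NeZero.pos e), ih]
    simp only [e2, e3]
    split_ifs <;> omega

/-- Here column `i` is black, so the walk rises until level 1 at `i + 2` and is constant afterwards.
If it did not rise, a minimum at level 1 would have no last occurrence, whence the field `lt_of_one`
of `IsGoodLevel`. -/
theorem potential_above (hA : A.HasCylindricHeight e) (i : ℤ) {r : ℤ}
    (h1 : A.level e 1 (i + 1) ≤ r) :
    A.potential e i r = A.levelPotential e i 1 +
      (min r (A.level e 1 (i + 1 + 1)) - A.level e 1 (i + 1)) := by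
  classical
  induction r, h1 using Int.leInduction with
  | base =>
    have := level_le_level_succ hA one_pos (i + 1)
    rw [levelPotential]
    omega
  | succ r h1 ih =>
    have e1 : A.height e (i + 1) r = 0 := by
      have := lt_level_iff hA one_pos (i + 1) r
      have := height_nonneg e A (i + 1) r
      omega
    have e2 : (i, r) ∈ A.stack e := by
      rw [mem_stack_iff_height]
      have := height_succ_cases e A i r
      have := height_nonneg e A i r
      omega
    have e3 : (i + 1, r) ∈ A.stack e ↔ A.level e 1 (i + 1 + 1) ≤ r := by
      rw [mem_stack_iff_height, ← not_lt, lt_level_iff hA (by omega)]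
      have := height_succ_cases e A (i + 1) r
      omega
    rw [potential_succ A (NeZero.pos e), ih, if_pos e2]
    simp only [e3]
    split_ifs <;> omega

/-- The right side is the number of beads of height `a` in column `i` minus that in column `i + 1`.
-/
theorem levelPotential_sub (hA : A.HasCylindricHeight e) {a : ℤ} (ha : 0 < a) (i : ℤ) :
    A.levelPotential e i a - A.levelPotential e i (a + 1) =
      A.level e a i + A.level e (a + 1) (i + 1 + 1) -
      A.level e a (i + 1) - A.level e (a + 1) (i + 1) := by
  have h := potential_between hA ha i (level_antitone hA ha (by omega) (i + 1)) le_rfl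
  have h1 := level_le_level_succ hA ha i
  have h2 := level_succ_succ_le hA ha (i + 1)
  rw [min_eq_right h1, max_eq_left h2] at h
  rw [levelPotential, h]
  ring

/-- The crystal operator of colour `i` acts on the `a`-th level. -/
structure IsGoodLevel (e : ℕ) (A : Abacus ℓ) (i a : ℤ) : Prop where
  pos : 0 < a
  le : ∀ b ≥ a, A.levelPotential e i a ≤ A.levelPotential e i b
  lt : ∀ b > 0, b < a → A.levelPotential e i a < A.levelPotential e i b
  lt_of_one : a = 1 → A.level e 1 (i + 1) < A.level e 1 (i + 1 + 1)

theorem levelPotential_nonneg_iff (hA : A.HasCylindricHeight e) (i : ℤ) :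
    (∀ r, 0 ≤ A.potential e i r) ↔ ∀ a > 0, 0 ≤ A.levelPotential e i a := by
  refine ⟨fun h a _ => h _, fun h r => ?_⟩
  rcases le_or_gt (A.level e 1 (i + 1)) r with hr | hr
  · have h1 := potential_above hA i hr
    have h2 := h 1 one_pos
    have h3 := level_le_level_succ hA one_pos (i + 1)
    omega
  · rw [lt_level_iff hA one_pos] at hr
    have hb : 0 < A.height e (i + 1) r := by omega
    have h1 := (lt_level_iff hA hb (i + 1) r).2 le_rfl
    have h2 := lt_level_iff hA (show 0 < A.height e (i + 1) r + 1 by omega) (i + 1) r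
    generalize A.height e (i + 1) r = b at *
    have h3 := potential_between hA hb i (by omega) h1.le
    have h4 := levelPotential_sub hA hb i
    have h5 := h b hb
    have h6 := h (b + 1) (by omega)
    have := level_le_level_succ hA hb i
    have := level_succ_succ_le hA hb (i + 1)
    omega

/-- Strict minimality prevents levels `a` and `a - 1` from meeting at column `i + 1`. -/
theorem IsGoodLevel.height_eq (hA : A.HasCylindricHeight e) {i a : ℤ}
    (h : A.IsGoodLevel e i a) : A.height e (i + 1) (A.level e a (i + 1)) = a - 1 := by
  have ha := h.pos
  have h1 := lt_level_iff hA ha (i + 1) (A.level e a (i + 1))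
  have h2 := height_nonneg e A (i + 1) (A.level e a (i + 1))
  rcases (show a = 1 ∨ 0 < a - 1 by omega) with rfl | h0
  · omega
  · have h3 := h.lt (a - 1) h0 (by omega)
    have h4 := level_antitone hA h0 (show a - 1 ≤ a by omega) (i + 1)
    have h5 : A.level e a (i + 1) ≠ A.level e (a - 1) (i + 1) := fun h => by
      rw [levelPotential, levelPotential, h] at h3
      exact lt_irrefl _ h3
    have h6 := lt_level_iff hA h0 (i + 1) (A.level e a (i + 1))
    omega

theorem isLastArgmin_iff (hA : A.HasCylindricHeight e) (i g : ℤ) :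
    IsLastArgmin (A.potential e i) g ↔
      ∃ a, A.IsGoodLevel e i a ∧ g = A.level e a (i + 1) := by
  constructor
  · intro h
    obtain ⟨⟨hb, hw⟩, -⟩ := h.letter (NeZero.pos e)
    have h0 := height_nonneg e A (i + 1) g
    have h1 := height_succ_of_mem e A hb
    have h2 := height_succ_of_notMem e A hw
    obtain ⟨a, hag⟩ : ∃ a, A.height e (i + 1) g = a - 1 := ⟨A.height e (i + 1) g + 1, by ring⟩
    have ha : 0 < a := by omega
    have h3 := lt_level_iff hA ha (i + 1) g
    have h4 := (lt_level_iff hA ha (i + 1 + 1) g).2 (by omega)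
    -- Otherwise the walk would strictly rise from the level up to `g`, against minimality at `g`.
    have hg : g = A.level e a (i + 1) := by
      by_contra hne
      have h5 := h.1 (A.level e a (i + 1)) (by omega)
      rcases (show a = 1 ∨ 0 < a - 1 by omega) with rfl | h0
      · have h6 := potential_above hA i (r := g) (by omega)
        rw [levelPotential] at h6
        omega
      · have h7 := (lt_level_iff hA h0 (i + 1) g).2 (by omega)
        have h8 := (lt_level_iff hA h0 i g).2 (by omega)
        have h6 := potential_between hA h0 i (r := g) (by rw [sub_add_cancel]; omega) h7.le
        rw [levelPotential, sub_add_cancel] at h6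
        omega
    refine ⟨a, ⟨ha, fun b hb => ?_, fun b hb hlt => ?_, ?_⟩, hg⟩
    · rw [levelPotential, ← hg]
      exact h.1 _ (hg ▸ level_antitone hA ha hb _)
    · rw [levelPotential, ← hg]
      exact h.2 _ ((lt_level_iff hA hb (i + 1) g).2 (by omega))
    · rintro rfl
      omega
  · rintro ⟨a, ha, rfl⟩
    have key : ∀ d, d < A.level e 1 (i + 1) → ∃ b > 0, A.level e (b + 1) (i + 1) ≤ d ∧
        d < A.level e b (i + 1) := by
      intro d hd
      rw [lt_level_iff hA one_pos] at hd
      refine ⟨A.height e (i + 1) d, by omega, ?_, ?_⟩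
      · rw [← not_lt, lt_level_iff hA (by omega)]
        omega
      · rw [lt_level_iff hA (by omega)]
    have hm := fun b hb => level_antitone (b := b) hA ha.pos hb (i + 1)
    have hm' := fun b h0 hb => level_antitone (a := b) (b := a) hA h0 hb (i + 1)
    change (∀ d ≤ _, A.levelPotential e i a ≤ _) ∧ ∀ d > _, A.levelPotential e i a < _
    constructor
    · intro d hd
      rcases hd.eq_or_lt with rfl | hd
      · exact le_rfl
      · obtain ⟨b, h0, h1, h2⟩ := key d (by
          have := hm' 1 one_pos ha.pos
          omega)
        have hb : a ≤ b := by
          by_contra! hlt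
          have := level_antitone hA (show 0 < b + 1 by omega) (show b + 1 ≤ a by omega) (i + 1)
          omega
        have h3 := potential_between hA h0 i h1 h2.le
        have h4 := levelPotential_sub hA h0 i
        have h5 := ha.le b hb
        have h6 := ha.le (b + 1) (by omega)
        have := level_le_level_succ hA h0 i
        have := level_succ_succ_le hA h0 (i + 1)
        omega
    · intro d hd
      rcases le_or_gt (A.level e 1 (i + 1)) d with hr | hr
      · have h1 := potential_above hA i hr
        have h3 := level_le_level_succ hA one_pos (i + 1)
        rcases (show a = 1 ∨ 1 < a by have := ha.pos; omega) with rfl | h0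
        · have := ha.lt_of_one rfl
          omega
        · have := ha.lt 1 one_pos h0
          omega
      · obtain ⟨b, h0, h1, h2⟩ := key d hr
        have hb : b < a := by
          by_contra! hlt
          have := hm b hlt
          omega
        have h3 := potential_between hA h0 i h1 h2.le
        have h4 := levelPotential_sub hA h0 i
        have h5 := ha.lt b h0 hb
        have := level_le_level_succ hA h0 i
        have := level_succ_succ_le hA h0 (i + 1)
        have := level_succ_succ_le hA h0 i
        have := level_le_level_succ hA (show 0 < b + 1 by omega) (i + 1)
        -- If the segment starts at the minimum itself, concavity and the strictly larger right end
        -- keep the walk strictly above it after the start.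
        rcases (show a = b + 1 ∨ b + 1 < a by omega) with rfl | hlt
        · omega
        · have h6 := ha.lt (b + 1) (by omega) hlt
          omega

/-! ### Crystal arrows in terms of levels -/

theorem eq_of_forall_pos_le_iff {p q : ℤ} (hp : 0 ≤ p) (hq : 0 ≤ q)
    (h : ∀ b > 0, b ≤ p ↔ b ≤ q) : p = q := by
  have h1 := h p
  have h2 := h q
  omega

-- The box is added at the first row above level `a`, where the height is `a - 1`. Raising it to `a`
-- extends that level by one row and leaves the other levels alone.
open Classical in
theorem lt_level_add_iff (hA : A.HasCylindricHeight e) {i a : ℤ} (h : A.IsGoodLevel e i a)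
    {b : ℤ} (hb : 0 < b) (c R : ℤ) :
    R < A.level e b c + (if b = a ∧ (e : ℤ) ∣ c - (i + 1) then 1 else 0) ↔
      b ≤ A.height e c R +
        if SamePosition ℓ e c R (i + 1) (A.level e a (i + 1)) then 1 else 0 := by
  have ha := h.pos
  have hL := lt_level_iff hA hb c R
  by_cases hd : (e : ℤ) ∣ c - (i + 1)
  · have hd' := hd
    obtain ⟨n, hn⟩ := hd'
    obtain rfl : c = i + 1 + e * n := by linarith
    have hs : SamePosition ℓ e (i + 1 + e * n) R (i + 1) (A.level e a (i + 1)) ↔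
        R = A.level e a (i + 1 + e * n) := by
      rw [level_periodic hA ha]
      refine ⟨fun hs => ?_, fun hs => ⟨n, rfl, hs⟩⟩
      obtain ⟨m, h1, h2⟩ := hs
      have he : (e : ℤ) ≠ 0 := by exact_mod_cast NeZero.ne e
      have : n = m := mul_left_cancel₀ he (by linarith)
      rw [this, h2]
    simp only [hs, hd, and_true]
    have hh := h.height_eq hA
    rw [← height_periodic e A _ _ n, ← level_periodic hA ha] at hh
    generalize i + 1 + e * n = c at *
    by_cases hR : R = A.level e a c
    · subst hR
      rw [if_pos rfl]
      split_ifs with hba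
      · subst hba
        omega
      · omega
    · rw [if_neg hR]
      split_ifs with hba
      · subst hba
        omega
      · omega
  · have hs : ¬ SamePosition ℓ e c R (i + 1) (A.level e a (i + 1)) := by
      rintro ⟨n, h1, -⟩
      exact hd ⟨n, by linarith⟩
    simp only [hd, hs, and_false, if_false, add_zero, hL]

open Classical in
theorem crystalArrow_iff_level (hA : A.HasCylindricHeight e) (hB : B.HasCylindricHeight e)
    (i : ℤ) : CrystalArrow e (i : ZMod e) A B ↔ ∃ a, A.IsGoodLevel e i a ∧
      ∀ b > 0, ∀ c, B.level e b c =
        A.level e b c + if b = a ∧ (e : ℤ) ∣ c - (i + 1) then 1 else 0 := by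
  have he := NeZero.pos e
  rw [crystalArrow_iff_isMove he]
  constructor
  · rintro ⟨g, hg, hm⟩
    obtain ⟨a, ha, rfl⟩ := (isLastArgmin_iff hA i g).1 hg
    refine ⟨a, ha, fun b hb c => ?_⟩
    have hh := (isMove_iff_height hm.black hm.white).1 hm
    have key : ∀ R, R < B.level e b c ↔
        R < A.level e b c + (if b = a ∧ (e : ℤ) ∣ c - (i + 1) then 1 else 0) := fun R => by
      rw [lt_level_add_iff hA ha hb, lt_level_iff hB hb, hh]
    generalize A.level e b c + _ = q at key
    have h1 := key q
    have h2 := key (B.level e b c)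
    omega
  · rintro ⟨a, ha, h⟩
    have hg := (isLastArgmin_iff hA i _).2 ⟨a, ha, rfl⟩
    have hL := (hg.letter he).1
    refine ⟨_, hg, (isMove_iff_height hL.1 hL.2).2 fun c R => ?_⟩
    refine eq_of_forall_pos_le_iff (height_nonneg ..) ?_ fun b hb => ?_
    · have := height_nonneg e A c R
      split_ifs <;> omega
    · rw [← lt_level_iff hB hb, h b hb, lt_level_add_iff hA ha hb]

/-- The crystal operators preserve and reflect full heights. -/
theorem isFull_iff_of_crystalArrow (he : 1 < e) (hA : A.HasCylindricHeight e)
    (hB : B.HasCylindricHeight e) {i : ZMod e} (h : CrystalArrow e i A B) {a : ℤ} (ha : 0 < a) :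
    A.IsFull e a ↔ B.IsFull e a := by
  classical
  obtain ⟨i, rfl⟩ := ZMod.intCast_surjective i
  obtain ⟨a', hg, hl⟩ := (crystalArrow_iff_level hA hB i).1 h
  have ha1 : 0 < a + 1 := by omega
  have hsub := levelPotential_sub hA ha i
  rw [isFull_iff hA ha, isFull_iff hB ha]
  constructor
  · intro hF c
    rw [hl _ ha1, hl _ ha]
    have h1 := hF c
    -- Only here can a gap shrink. Goodness of level `a + 1` makes the gap of column `i` larger than
    -- the nonempty gap of column `i + 1`, so one row can be spared.
    by_cases hc : a + 1 = a' ∧ (e : ℤ) ∣ c + 1 - (i + 1)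
    · rw [if_pos hc, if_neg (by omega)]
      obtain ⟨rfl, n, hn⟩ := hc
      obtain rfl : c = i + e * n := by linarith
      rw [show i + e * n + 1 = i + 1 + e * n by ring, level_periodic hA ha1,
        level_periodic hA ha] at h1 ⊢
      have h2 := hg.lt a ha (by omega)
      have h3 := hF (i + 1)
      omega
    · rw [if_neg hc]
      split_ifs <;> omega
  · intro hF c
    have h1 := hF c
    rw [hl _ ha1, hl _ ha] at h1
    -- The gap of column `i` is unchanged, hence nonempty before the arrow. Goodness of level `a`
    -- makes the gap of column `i + 1` at least as large.
    by_cases hc : a = a' ∧ (e : ℤ) ∣ c - (i + 1)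
    · obtain ⟨rfl, n, hn⟩ := hc
      obtain rfl : c = i + 1 + e * n := by linarith
      have h2 := hg.le (a + 1) (by omega)
      have h3 := hF i
      have hnd : ¬ (e : ℤ) ∣ i - (i + 1) := fun hd => by
        have := Int.le_of_dvd one_pos ((dvd_neg.2 hd).trans (by ring_nf; rfl))
        omega
      rw [hl _ ha1, hl _ ha, if_neg (by omega), if_neg (fun h => hnd h.2)] at h3
      rw [show i + 1 + e * n + 1 = i + 1 + 1 + e * n by ring, level_periodic hA ha1,
        level_periodic hA ha]
      have h4 := level_succ_succ_le hA ha (i + 1)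
      omega
    · rw [if_neg hc] at h1
      split_ifs at h1 <;> omega

/-- The crystal operators reflect the cylindric condition. -/
theorem HasCylindricHeight.of_crystalArrow (he : 1 < e) (hB : B.HasCylindricHeight e)
    {i : ZMod e} (h : CrystalArrow e i A B) : A.HasCylindricHeight e := by
  classical
  obtain ⟨i, rfl⟩ := ZMod.intCast_surjective i
  have he0 := NeZero.pos e
  have he' : (e : ℤ) ≠ 0 := by exact_mod_cast he0.ne'
  have hl' : (ℓ : ℤ) ≠ 0 := by exact_mod_cast NeZero.ne ℓ
  obtain ⟨g, hg, hm⟩ := (crystalArrow_iff_isMove he0 i A B).1 h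
  have hh := (isMove_iff_height hm.black hm.white).1 hm
  have hcol : ∀ k R, ¬ (e : ℤ) ∣ k - (i + 1) → B.height e k R = A.height e k R := by
    intro k R hk
    rw [hh, if_neg, add_zero]
    rintro ⟨n, h1, -⟩
    exact hk ⟨n, by linarith⟩
  have hd1 : ¬ (e : ℤ) ∣ 1 := fun hd => by
    have := Int.le_of_dvd one_pos hd
    omega
  have hdi : ¬ (e : ℤ) ∣ i - (i + 1) := fun hd => hd1 ((dvd_neg.2 hd).trans (by ring_nf; rfl))
  have hdi' : ¬ (e : ℤ) ∣ i + 1 + 1 - (i + 1) := fun hd => hd1 (hd.trans (by ring_nf; rfl))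
  -- A failure would make row `g + 1` removable, so the walk would return at `g + 2` to its value at
  -- `g`, which is its last minimum.
  have main : A.height e (i + 1) (g + 1) ≤ A.height e (i + 1) g := by
    by_contra! hlt
    have h1 := hB i g
    have h2 := hB (i + 1 + 1) g
    rw [hcol _ _ hdi, hcol _ _ hdi] at h1
    rw [hcol _ _ hdi', hcol _ _ hdi'] at h2
    have h3 := height_succ_of_mem e A hm.black
    have h4 := height_succ_of_notMem e A hm.white
    have h5 := height_succ_cases e A i (g + 1)
    have h6 := height_succ_cases e A (i + 1) (g + 1)
    have h7 : (i, g + 1) ∉ A.stack e := by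
      rw [mem_stack_iff_height]; omega
    have h8 : (i + 1, g + 1) ∈ A.stack e := by
      rw [mem_stack_iff_height]; omega
    have h9 := potential_succ A he0 i (g + 1)
    rw [if_neg h7, if_pos h8] at h9
    have h10 := (hg.letter he0).2
    have := hg.2 (g + 1 + 1) (by omega)
    omega
  intro c R
  by_cases hs : SamePosition ℓ e c R (i + 1) g
  · obtain ⟨n, rfl, rfl⟩ := hs
    rw [show g + ℓ * n + 1 = g + 1 + ℓ * n by ring, height_periodic, height_periodic]
    exact main
  · have h1 := hB c R
    rw [hh, hh, if_neg hs] at h1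
    split_ifs at h1 <;> omega

end level

/-! ### Lowering a full level. -/

section lowering

variable {ℓ e : ℕ} [NeZero ℓ] [NeZero e] {A B C : Abacus ℓ}

/-- `B` is obtained from `C` by moving, in each column of the stacked abacus, the last bead of
height `a` one step to the left. -/
structure IsLowering (e : ℕ) (a : ℤ) (C B : Abacus ℓ) : Prop where
  pos : 0 < a
  cylindric_left : C.HasCylindricHeight e
  cylindric_right : B.HasCylindricHeight e
  level_eq : ∀ b > 0, ∀ c, B.level e b c = C.level e b c - if b = a then 1 else 0

/-- Fullness puts the topmost row under level `a` inside the gap, so a bead of height `a` stands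
there and can be moved. -/
theorem IsFull.height_eq (hC : C.HasCylindricHeight e) {a : ℤ} (ha : 0 < a) (hF : C.IsFull e a)
    {c R : ℤ} (hR : R + 1 = C.level e a c) :
    C.height e c R = a ∧ C.height e (c + 1) R = a := by
  have h1 := (isFull_iff hC ha).1 hF c
  have h2 := (mem_and_height_eq_iff hC ha c R).2 (by omega)
  exact ⟨h2.2, (height_succ_of_mem e C h2.1).trans h2.2⟩

theorem exists_isLowering (hC : C.HasCylindricHeight e) {a : ℤ} (ha : 0 < a)
    (hF : C.IsFull e a) : ∃ B, IsLowering e a C B := by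
  classical
  -- The heights of the abacus to be built: in each column the topmost row of height at least `a`
  -- loses one.
  obtain ⟨f, hf⟩ : ∃ f : ℤ → ℤ → ℤ, ∀ c R, f c R =
    C.height e c R - if R + 1 = C.level e a c then 1 else 0 := ⟨_, fun _ _ => rfl⟩
  have hstep : ∀ c R, f (c + 1) R = f c R ∨ f (c + 1) R = f c R + 1 := by
    intro c R
    have h1 := level_le_level_succ hC ha c
    have h2 := lt_level_iff hC ha c R
    have h3 := lt_level_iff hC ha (c + 1) R
    have h4 := height_succ_cases e C c R
    have h5 := fun h : R + 1 = C.level e a c => hF.height_eq hC ha h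
    rw [hf, hf]
    split_ifs with h6 h7 h7
    · omega
    · omega
    · have := h5 h7; omega
    · omega
  have hper : ∀ c R n, f (c + e * n) (R + ℓ * n) = f c R := by
    intro c R n
    rw [hf, hf, height_periodic, level_periodic hC ha]
    have : R + ℓ * n + 1 = C.level e a c + ℓ * n ↔ R + 1 = C.level e a c := by
      constructor <;> intro h <;> linarith
    simp only [this]
  have hleft : ∀ R, ∃ M, ∀ c ≤ M, f c R = 0 := by
    intro R
    obtain ⟨M, hM⟩ := exists_height_eq_zero e C R
    refine ⟨M, fun c hc => ?_⟩
    have h1 := hM c hc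
    rw [hf, if_neg, h1, sub_zero]
    intro h
    have := hF.height_eq hC ha h
    omega
  obtain ⟨B, hB⟩ := exists_stack_eq (x := ℓ) (y := e) {p | f (p.1 + 1) p.2 = f p.1 p.2}
    (fun c R n => by
      simp only [Set.mem_ofPred_eq]
      rw [hper, show c + e * n + 1 = c + 1 + e * n by ring, hper])
    (fun R => by
      obtain ⟨M, hM⟩ := hleft R
      refine ⟨M - 1, fun c hc => ?_⟩
      simp only [Set.mem_ofPred_eq]
      rw [hM _ (by omega), hM _ (by omega)])
    (fun R => by
      obtain ⟨M, hM⟩ := exists_bound_right e C R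
      obtain ⟨N, hN⟩ := exists_le_height (e := e) C (R + 1) a
      refine ⟨max M N, fun c hc => ?_⟩
      have h1 := height_succ_of_notMem e C (hM c (by omega))
      have h2 := (lt_level_iff hC ha c (R + 1)).2 (hN c (by omega))
      have h3 := (lt_level_iff hC ha (c + 1) (R + 1)).2 (hN _ (by omega))
      simp only [Set.mem_ofPred_eq]
      rw [hf, hf, if_neg (by omega), if_neg (by omega)]
      omega)
  have hh : ∀ c R, B.height e c R = f c R := by
    intro c R
    refine height_eq_of_increments (f := fun c => f c R) e (hleft R) ?_ ?_ c
    · intro c hc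
      rwa [hB] at hc
    · intro c hc
      rw [hB] at hc
      exact (hstep c R).resolve_left hc
  have hBc : B.HasCylindricHeight e := by
    intro c R
    have h1 := hC c R
    have h2 := lt_level_iff hC ha c R
    have h3 := lt_level_iff hC ha c (R + 1)
    rw [hh, hh, hf, hf]
    split_ifs <;> omega
  refine ⟨B, ha, hC, hBc, fun b hb c => ?_⟩
  have key : ∀ R, R < B.level e b c ↔ R < C.level e b c - if b = a then 1 else 0 := by
    intro R
    have h1 := lt_level_iff hC hb c R
    have h2 := lt_level_iff hC ha c R
    have h5 := fun h : R + 1 = C.level e a c => hF.height_eq hC ha h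
    rw [lt_level_iff hBc hb, hh, hf]
    by_cases hba : b = a
    · subst hba
      rw [if_pos rfl]
      split_ifs with h6
      · have := h5 h6
        omega
      · omega
    · rw [if_neg hba]
      split_ifs with h6
      · have := h5 h6
        omega
      · omega
  generalize C.level e b c - _ = q at key
  have h1 := key q
  have h2 := key (B.level e b c)
  omega

/-- The potential vanishes on all levels of large height. -/
theorem exists_levelPotential_eq_zero (hA : A.HasCylindricHeight e) (i : ℤ) :
    ∃ N > 0, ∀ b ≥ N, A.levelPotential e i b = 0 := by
  obtain ⟨M, hM⟩ := exists_potential_eq_zero A (NeZero.pos e) i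
  have h0 := height_nonneg e A (i + 1) M
  refine ⟨A.height e (i + 1) M + 1, by omega, fun b hb => hM _ ?_⟩
  have := lt_level_iff hA (show 0 < b by omega) (i + 1) M
  omega

/-- In `levelPotential_sub` each of the two levels occurs once with each sign, so a uniform shift
cancels. Both potentials vanish for large indices. -/
theorem IsLowering.levelPotential_eq {a : ℤ} (h : IsLowering e a C B) (i : ℤ) {b : ℤ}
    (hb : 0 < b) : B.levelPotential e i b = C.levelPotential e i b := by
  have key : ∀ N, b ≤ N → B.levelPotential e i b - C.levelPotential e i b =
      B.levelPotential e i N - C.levelPotential e i N := by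
    intro N hN
    induction N, hN using Int.leInduction with
    | base => rfl
    | succ N hN ih =>
      have hN0 : 0 < N := by omega
      have hN1 : 0 < N + 1 := by omega
      have h1 := levelPotential_sub h.cylindric_left hN0 i
      have h2 := levelPotential_sub h.cylindric_right hN0 i
      rw [h.level_eq _ hN0, h.level_eq _ hN0, h.level_eq _ hN1, h.level_eq _ hN1] at h2
      linarith
  obtain ⟨M, hM0, hM⟩ := exists_levelPotential_eq_zero h.cylindric_left i
  obtain ⟨N, hN0, hN⟩ := exists_levelPotential_eq_zero h.cylindric_right i
  have := key (max b (max M N)) (by omega)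
  rw [hM (max b (max M N)) (by omega), hN (max b (max M N)) (by omega)] at this
  linarith

theorem IsLowering.isGoodLevel {a : ℤ} (h : IsLowering e a C B) {i b : ℤ}
    (hb : C.IsGoodLevel e i b) : B.IsGoodLevel e i b where
  pos := hb.pos
  le b' hb' := by
    have := hb.pos
    rw [h.levelPotential_eq i hb.pos, h.levelPotential_eq i (by omega)]
    exact hb.le b' hb'
  lt b' h0 hb' := by
    rw [h.levelPotential_eq i hb.pos, h.levelPotential_eq i h0]
    exact hb.lt b' h0 hb'
  lt_of_one h1 := by
    rw [h.level_eq _ one_pos, h.level_eq _ one_pos]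
    have := hb.lt_of_one h1
    omega

theorem IsLowering.isSource (he : 1 < e) {a : ℤ} (h : IsLowering e a C B)
    (hC : IsSource e C) : IsSource e B := by
  rw [isSource_iff he] at hC ⊢
  intro i
  rw [levelPotential_nonneg_iff h.cylindric_right]
  intro b hb
  rw [h.levelPotential_eq i hb]
  exact (levelPotential_nonneg_iff h.cylindric_left i).1 (hC i) b hb

/-- Lowering commutes with the crystal operators. -/
theorem IsLowering.crystalArrow {C' B' : Abacus ℓ} {a : ℤ} (h : IsLowering e a C B)
    (h' : IsLowering e a C' B') {i : ZMod e} (hC : CrystalArrow e i C C') :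
    CrystalArrow e i B B' := by
  classical
  obtain ⟨i, rfl⟩ := ZMod.intCast_surjective i
  obtain ⟨b, hb, hl⟩ := (crystalArrow_iff_level h.cylindric_left h'.cylindric_left i).1 hC
  refine (crystalArrow_iff_level h.cylindric_right h'.cylindric_right i).2
    ⟨b, h.isGoodLevel hb, fun b' h0 c => ?_⟩
  rw [h.level_eq b' h0, h'.level_eq b' h0, hl b' h0]
  ring

theorem exists_height_bound (e : ℕ) (A : Abacus ℓ) :
    ∃ K, ∀ c R, (c, R) ∈ A.stack e → A.height e c R ≤ K := by
  obtain ⟨M, hM⟩ := A.white_right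
  obtain ⟨K, hK⟩ := Finset.exists_le (Finset.univ.image fun j : Fin ℓ => A.rowHeight j M)
  refine ⟨K, fun c R h => ?_⟩
  obtain ⟨j, m, rfl⟩ := exists_row (x := ℓ) R
  rw [mem_stack] at h
  rw [height_row]
  exact (rowHeight_mono A j (le_of_not_ge fun hge => hM _ hge j h)).trans
    (hK _ (Finset.mem_image_of_mem _ (Finset.mem_univ j)))

/-- In a source, the largest height of a bead is full, unless it is zero. -/
theorem exists_isFull_of_isSource (he : 1 < e) (hA : A.HasCylindricHeight e)
    (hs : IsSource e A) {c₀ R₀ : ℤ} (hb : (c₀, R₀) ∈ A.stack e) (h0 : 0 < A.height e c₀ R₀) :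
    ∃ a > 0, A.IsFull e a := by
  obtain ⟨K, hK⟩ := exists_height_bound e A
  obtain ⟨a, ⟨c₁, R₁, h1, ha1⟩, hmax⟩ := Int.exists_greatest_of_bdd
    (P := fun a => ∃ c R, (c, R) ∈ A.stack e ∧ A.height e c R = a)
    ⟨K, by rintro _ ⟨c, R, h1, rfl⟩; exact hK c R h1⟩ ⟨_, c₀, R₀, hb, rfl⟩
  have ha : 0 < a := lt_of_lt_of_le h0 (hmax _ ⟨c₀, R₀, hb, rfl⟩)
  have hnone : ∀ b > a, ∀ c, A.level e (b + 1) (c + 1) = A.level e b c := by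
    intro b hba c
    have hb0 : 0 < b := by omega
    by_contra hne
    have h2 := level_succ_succ_le hA hb0 c
    obtain ⟨h3, h4⟩ := (mem_and_height_eq_iff hA hb0 c (A.level e b c - 1)).2 (by omega)
    have := hmax b ⟨_, _, h3, h4⟩
    omega
  -- Without beads of height above `a` these gaps are empty, so the potential is constant from `a +
  -- 1` on, hence zero.
  have hzero : ∀ i, A.levelPotential e i (a + 1) = 0 := by
    intro i
    have key : ∀ N, a + 1 ≤ N → A.levelPotential e i (a + 1) = A.levelPotential e i N := by
      intro N hN
      induction N, hN using Int.leInduction with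
      | base => rfl
      | succ N hN ih =>
        have h1 := levelPotential_sub hA (show 0 < N by omega) i
        have h2 := hnone N (by omega) i
        have h3 := hnone N (by omega) (i + 1)
        omega
    obtain ⟨N, hN0, hN⟩ := exists_levelPotential_eq_zero hA i
    rw [key (max (a + 1) N) (by omega), hN _ (by omega)]
  refine ⟨a, ha, (isFull_iff hA ha).2 ?_⟩
  -- The source condition now says that the gaps for `a` do not grow from one column to the next.
  -- Being `e`-periodic, they are constant, and one of them is nonempty.
  have hanti : Antitone fun c => A.level e a c - A.level e (a + 1) (c + 1) := by
    refine antitone_int_of_succ_le fun i => ?_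
    have h1 := levelPotential_sub hA ha i
    have h2 := ((levelPotential_nonneg_iff hA i).1 ((isSource_iff he A).1 hs i)) a ha
    have h3 := hzero i
    omega
  have hpos : 0 < A.level e a c₁ - A.level e (a + 1) (c₁ + 1) := by
    have := (mem_and_height_eq_iff hA ha c₁ R₁).1 ⟨h1, ha1⟩
    omega
  intro c
  have h2 := hanti (show c ≤ c₁ + e * (|c| + |c₁|) by
    have := le_abs_self c
    have := neg_abs_le c₁
    have he' : (1 : ℤ) < e := by exact_mod_cast he
    nlinarith [abs_nonneg c, abs_nonneg c₁])
  simp only at h2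
  rw [show c₁ + e * (|c| + |c₁|) + 1 = c₁ + 1 + e * (|c| + |c₁|) by ring,
    level_periodic hA ha, level_periodic hA (by omega)] at h2
  omega

/-! ### Induction along the crystal -/

/-- A cylindric property holds for all cylindric abaci if it holds for sources and is preserved by
the crystal arrows. -/
theorem HasCylindricHeight.crystal_induction (he : 1 < e) {P : Abacus ℓ → Prop}
    (hsource : ∀ A, A.HasCylindricHeight e → IsSource e A → P A)
    (harrow : ∀ (i : ZMod e) (A B : Abacus ℓ), A.HasCylindricHeight e → B.HasCylindricHeight e →
      CrystalArrow e i A B → P A → P B) (hA : A.HasCylindricHeight e) : P A := by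
  classical
  obtain ⟨K, hK⟩ := A.white_right
  obtain ⟨N, hN⟩ := A.black_left
  -- The sum of heights over a fixed window strictly drops when an arrow is undone, and the bounds
  -- `N` and `K` persist.
  obtain ⟨n, hn⟩ : ∃ n : ℕ, ∑ j : Fin ℓ, ∑ c ∈ Finset.Icc N K, A.rowHeight j c < n := by
    obtain ⟨m, hm⟩ := Int.eq_ofNat_of_zero_le
      (show 0 ≤ ∑ j : Fin ℓ, ∑ c ∈ Finset.Icc N K, A.rowHeight j c from
        Finset.sum_nonneg fun j _ => Finset.sum_nonneg fun c _ => below_nonneg _ _)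
    exact ⟨m + 1, by rw [hm]; push_cast; exact lt_add_one _⟩
  induction n generalizing A with
  | zero =>
    exact absurd hn (not_lt.2 (Finset.sum_nonneg fun j _ => Finset.sum_nonneg fun c _ =>
      below_nonneg _ _))
  | succ n ih =>
    by_cases hs : IsSource e A
    · exact hsource A hA hs
    · rw [IsSource] at hs
      push Not at hs
      obtain ⟨i, B, hBA⟩ := hs
      have hB := hA.of_crystalArrow he hBA
      refine harrow i B A hB hA hBA ?_
      obtain ⟨i, rfl⟩ := ZMod.intCast_surjective i
      obtain ⟨g, hg, hm⟩ := (crystalArrow_iff_isMove (NeZero.pos e) i B A).1 hBA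
      have hh := (isMove_iff_height hm.black hm.white).1 hm
      have hh' : ∀ j c, A.rowHeight j c = B.rowHeight j c +
          if SamePosition ℓ e c (((j : Fin ℓ) : ℤ) + 1 + ℓ * 0) (i + 1) g then 1 else 0 := by
        intro j c
        have := hh c ((j : ℤ) + 1 + ℓ * 0)
        rw [height_row, height_row] at this
        simpa only [mul_zero, sub_zero] using this
      have hw : ∀ β ≥ K, ∀ j, (β, j) ∉ B.carrier := by
        intro β hβ j hmem
        have hmem' := (mem_stack e B β j 0).2 (by simpa using hmem)
        by_cases hsp : SamePosition ℓ e β ((j : ℤ) + 1 + ℓ * 0) i g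
        · have := (hm.mem_iff (β + 1) ((j : ℤ) + 1 + ℓ * 0)).2
            (Or.inl ((samePosition_add ..).2 hsp))
          rw [mem_stack] at this
          exact hK (β + 1) (by omega) j (by simpa using this)
        · have := (hm.mem_iff β ((j : ℤ) + 1 + ℓ * 0)).2 (Or.inr ⟨hmem', hsp⟩)
          rw [mem_stack] at this
          exact hK β hβ j (by simpa using this)
      obtain ⟨j, m, hR⟩ := exists_row (x := ℓ) g
      have hsp : ∀ c, c = i + 1 - e * m →
          SamePosition ℓ e c ((j : ℤ) + 1 + ℓ * 0) (i + 1) g :=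
        fun c hc => ⟨-m, by rw [hc]; ring, by rw [hR]; ring⟩
      have hb : ∀ β ≤ N, ∀ j, (β, j) ∈ B.carrier := by
        intro β hβ j
        have h1 := hN β hβ j
        by_contra h2
        have h3 := (hm.mem_iff β ((j : ℤ) + 1 + ℓ * 0)).1
          ((mem_stack ..).2 (by simpa using h1))
        rcases h3 with h3 | h3
        · have h4 : SamePosition ℓ e (β - 1) ((j : ℤ) + 1 + ℓ * 0) i g := by
            rw [← samePosition_add _ _ _ _ 1, sub_add_cancel]
            exact h3
          have h5 : (β - 1, (j : ℤ) + 1 + ℓ * 0) ∉ A.stack e := by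
            rw [hm.mem_iff, not_or]
            refine ⟨fun h => ?_, fun h => h.2 h4⟩
            have := h.eq_of_row h4
            omega
          rw [mem_stack] at h5
          exact h5 (by simpa using hN (β - 1) (by omega) j)
        · have := (mem_stack ..).1 h3.1
          exact h2 (by simpa using this)
      refine ih hB hw hb ?_
      have hlt : ∑ j : Fin ℓ, ∑ c ∈ Finset.Icc N K, B.rowHeight j c <
          ∑ j : Fin ℓ, ∑ c ∈ Finset.Icc N K, A.rowHeight j c := by
        have hle : ∀ j c, B.rowHeight j c ≤ A.rowHeight j c := by
          intro j c
          rw [hh' j c]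
          split_ifs <;> omega
        refine Finset.sum_lt_sum (fun j _ => Finset.sum_le_sum fun c _ => hle j c)
          ⟨j, Finset.mem_univ j, Finset.sum_lt_sum (fun c _ => hle j c) ⟨i + 1 - e * m, ?_, ?_⟩⟩
        · have h1 := (hm.mem_iff _ ((j : ℤ) + 1 + ℓ * 0)).2 (Or.inl (hsp _ rfl))
          rw [mem_stack] at h1
          have h2 : ¬ (i + 1 - e * m - e * 0 ≥ K) := fun h => hK _ h j h1
          have h3 : SamePosition ℓ e (i - e * m) ((j : ℤ) + 1 + ℓ * 0) i g :=
            ⟨-m, by ring, by rw [hR]; ring⟩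
          have h5 : (i - e * m, (j : ℤ) + 1 + ℓ * 0) ∉ A.stack e := by
            rw [hm.mem_iff, not_or]
            refine ⟨fun h => ?_, fun h => h.2 h3⟩
            have := h.eq_of_row h3
            omega
          rw [mem_stack] at h5
          have h6 : ¬ (i - e * m - e * 0 ≤ N) := fun h => h5 (hN _ h j)
          rw [Finset.mem_Icc]
          constructor <;> linarith
        · rw [hh' j, if_pos (hsp _ rfl)]
          omega
      push_cast at hn
      omega

end lowering

/-! ### Periods of the dual and Heisenberg arrows. -/

section heisenberg

variable {ℓ e : ℕ} [NeZero ℓ] [NeZero e]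

omit [NeZero e] in
theorem mem_dual_iff (A : Abacus ℓ) (R : ℤ) (j : Fin e) :
    (R, j) ∈ (A.dual e).carrier ↔ ((j : ℤ) + 1 - e, R) ∉ A.stack e := Iff.rfl

theorem IsPeriod.exists_column {y x : ℕ} {S : Set (ℤ × Fin x)} {P : Fin y → ℤ × Fin x}
    (h : IsPeriod y S P) : ∃ β, ∀ i, (P i).1 = β - (i : ℤ) := by
  induction h with
  | first h =>
    obtain ⟨β, -, h, -⟩ := h
    exact ⟨β, h⟩
  | next _ _ ih => exact ih

omit [NeZero e] in
/-- If the dual of `D` is obtained by shifting a period, then `D` has a bead of positive height. -/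
theorem exists_height_pos_of_isPeriodShift {D : Abacus ℓ} (hD : D.HasCylindricHeight e)
    {B : Abacus e} (h : IsPeriodShift ℓ B (D.dual e)) :
    ∃ c R, (c, R) ∈ D.stack e ∧ 0 < D.height e c R := by
  obtain ⟨P, hP, -, hC⟩ := h
  obtain ⟨β, hβ⟩ := hP.exists_column
  have hl := NeZero.pos ℓ
  -- The last bead of a period is its leftmost one. Its place is vacated, since every shifted bead
  -- lies further right.
  obtain ⟨i, hi⟩ : ∃ i : Fin ℓ, (i : ℕ) + 1 = ℓ := ⟨⟨ℓ - 1, by omega⟩, by simp only; omega⟩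
  have h1 : ((P i).1, (P i).2) ∉ (D.dual e).carrier := by
    rw [hC]
    rintro (h | ⟨k, hk⟩)
    · exact h.2 ⟨i, rfl⟩
    · have h2 := congrArg Prod.fst hk
      simp only [hβ] at h2
      have := k.2
      omega
  have h2 : ((P i).1 + 1, (P i).2) ∈ (D.dual e).carrier := by
    rw [hC]
    exact Or.inr ⟨i, rfl⟩
  rw [mem_dual_iff, not_not] at h1
  rw [mem_dual_iff] at h2
  refine ⟨_, _, h1, ?_⟩
  have h3 := height_succ_of_mem e D h1
  have h4 := height_succ_of_notMem e D h2
  have h5 := hD ((P i).2 + 1 - e + 1) (P i).1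
  have h6 := height_nonneg e D ((P i).2 + 1 - e) ((P i).1 + 1)
  omega

omit [NeZero e] in
theorem notMem_stack_iff (B : Abacus ℓ) (c R : ℤ) : (c, R) ∉ B.stack e ↔
    ∃ b > 0, B.height e c R < b ∧ b ≤ B.height e (c + 1) R := by
  rw [mem_stack_iff_height]
  have h1 := height_nonneg e B c R
  have h2 := height_succ_cases e B c R
  constructor
  · intro h
    exact ⟨B.height e (c + 1) R, by omega, by omega, le_rfl⟩
  · rintro ⟨b, h3, h4, h5⟩
    omega

/-- `P` lists the `k`-th white positions of `ℓ` consecutive rows of the stacked abacus of `B`, namely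
those in the columns `1 - e, …, 0`, from top to bottom. -/
structure IsWhitePeriod (k : ℤ) (B : Abacus ℓ) (P : Fin ℓ → ℤ × Fin e) : Prop where
  row : ∀ i, (P i).1 = B.level e k 1 - 1 - (i : ℤ)
  column : ∀ i c, c ≤ ((P i).2 : ℤ) + 1 - e ↔ B.height e c (P i).1 < k

/-- The `k`-th white position of a row lies in columns `1 - e, …, 0` exactly between level `k` at `1
- e` and at `1`; by periodicity these are `ℓ` rows. -/
theorem exists_isWhitePeriod {B : Abacus ℓ} (hB : B.HasCylindricHeight e) {k : ℤ} (hk : 0 < k) :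
    ∃ P : Fin ℓ → ℤ × Fin e, IsWhitePeriod k B P := by
  have hcol : ∀ R, ∃ w, ∀ c, c ≤ w ↔ B.height e c R < k := by
    intro R
    obtain ⟨M, hM⟩ := exists_height_eq_zero e B R
    obtain ⟨N, hN⟩ := exists_le_height (e := e) B R k
    obtain ⟨w, hw, hmax⟩ := Int.exists_greatest_of_bdd (P := fun c => B.height e c R < k)
      ⟨N, fun c hc => le_of_not_ge fun h => by have := hN c h; omega⟩
      ⟨M, by rw [hM M le_rfl]; exact hk⟩
    exact ⟨w, fun c => ⟨fun h => (height_mono e B h R).trans_lt hw, hmax c⟩⟩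
  have hP : ∀ i : Fin ℓ, ∃ p : ℤ × Fin e, p.1 = B.level e k 1 - 1 - (i : ℤ) ∧
      ∀ c, c ≤ (p.2 : ℤ) + 1 - e ↔ B.height e c p.1 < k := by
    intro i
    obtain ⟨w, hw⟩ := hcol (B.level e k 1 - 1 - i)
    have h1 : ¬ 1 ≤ w := by
      rw [hw, not_lt, ← lt_level_iff hB hk]
      omega
    have h2 : 1 - e ≤ w := by
      rw [hw, ← not_le, ← lt_level_iff hB hk]
      have h3 := level_periodic hB hk 1 (-1)
      rw [show (1 : ℤ) + e * (-1) = 1 - e by ring] at h3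
      have := i.2
      rw [h3]
      omega
    refine ⟨(B.level e k 1 - 1 - i, ⟨(w + e - 1).toNat, by omega⟩), rfl, fun c => ?_⟩
    rw [← hw]
    simp only [Int.toNat_of_nonneg (show 0 ≤ w + e - 1 by omega)]
    rw [show w + e - 1 + 1 - e = w by ring]
  choose P h1 h2 using hP
  exact ⟨P, h1, h2⟩

theorem IsWhitePeriod.mem_range_iff {k : ℤ} {B : Abacus ℓ} {P : Fin ℓ → ℤ × Fin e}
    (hP : IsWhitePeriod k B P) (hB : B.HasCylindricHeight e) (hk : 0 < k) (R : ℤ) (j : Fin e) :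
    (R, j) ∈ Set.range P ↔
      B.height e ((j : ℤ) + 1 - e) R < k ∧ k ≤ B.height e ((j : ℤ) + 1 - e + 1) R := by
  constructor
  · rintro ⟨i, hi⟩
    have h := hP.column i
    rw [hi] at h
    simp only at h
    have h1 := h ((j : ℤ) + 1 - e)
    have h2 := h ((j : ℤ) + 1 - e + 1)
    omega
  · rintro ⟨h1, h2⟩
    have hj := j.2
    have h3 := (lt_level_iff hB hk 1 R).2 (h2.trans (height_mono e B (by omega) R))
    have h4 : ¬ R < B.level e k (1 - e) := by
      rw [lt_level_iff hB hk, not_le]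
      exact (height_mono e B (by omega) R).trans_lt h1
    have h5 := level_periodic hB hk 1 (-1)
    rw [show (1 : ℤ) + e * (-1) = 1 - e by ring] at h5
    obtain ⟨n, hn⟩ := Int.eq_ofNat_of_zero_le (show 0 ≤ B.level e k 1 - 1 - R by omega)
    refine ⟨⟨n, by omega⟩, ?_⟩
    have h6 := hP.row ⟨n, by omega⟩
    have h7 := hP.column ⟨n, by omega⟩
    have h8 : (P ⟨n, by omega⟩).1 = R := by rw [h6]; simp only; omega
    rw [h8] at h7
    have h9 := (h7 _).2 h1
    have h10 : ¬ _ := fun h => (not_lt.2 h2) ((h7 _).1 h)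
    refine Prod.ext h8 (Fin.ext ?_)
    simp only
    omega

/-- Among the white positions of rank at least `k`, the `k`-th is leftmost in its row. Cylindricity
moves it weakly left from each row to the one below. -/
theorem IsWhitePeriod.isFirstPeriod {k : ℤ} {B : Abacus ℓ} {P : Fin ℓ → ℤ × Fin e}
    (hP : IsWhitePeriod k B P) (hB : B.HasCylindricHeight e) (hk : 0 < k) :
    IsFirstPeriod ℓ {p | p ∈ (B.dual e).carrier ∧ k ≤ B.height e ((p.2 : ℤ) + 1 - e + 1) p.1} P := by
  have hmem : ∀ i, P i ∈ {p | p ∈ (B.dual e).carrier ∧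
      k ≤ B.height e ((p.2 : ℤ) + 1 - e + 1) p.1} := by
    intro i
    have h := (hP.mem_range_iff hB hk (P i).1 (P i).2).1 ⟨i, rfl⟩
    exact ⟨(notMem_stack_iff B _ _).2 ⟨k, hk, h.1, h.2⟩, h.2⟩
  refine ⟨B.level e k 1 - 1, ⟨?_, ?_⟩, hP.row, ?_, fun i => ⟨hmem i, ?_⟩⟩
  · have h0 := hP.row ⟨0, NeZero.pos ℓ⟩
    simp only [Nat.cast_zero, sub_zero] at h0
    exact ⟨(P ⟨0, NeZero.pos ℓ⟩).2, h0 ▸ hmem _⟩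
  · rintro γ ⟨j, hj⟩
    have hj' := j.2
    have := (lt_level_iff hB hk 1 γ).2 (hj.2.trans (height_mono e B (by simp only; omega) γ))
    omega
  · intro i i' hi
    have h1 := hP.row i
    have h2 := hP.row i'
    have hi' : (i : ℕ) ≤ i' := hi
    have h3 := (hP.column i' _).1 le_rfl
    by_contra hlt
    have h4 : ((P i).2 : ℕ) < (P i').2 := not_le.1 hlt
    have h5 := hP.column i ((P i').2 + 1 - e)
    have h6 := hB.antitone ((P i').2 + 1 - e) (show (P i').1 ≤ (P i).1 by omega)
    omega
  · rintro j hj ⟨-, h2⟩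
    have hj' : (j : ℕ) < (P i).2 := hj
    have := (hP.column i ((j : ℤ) + 1 - e + 1)).1 (by omega)
    simp only at h2
    omega

/-- Removing the period of rank `k` leaves the positions of rank at least `k + 1`, so the periods
are peeled off one by one. -/
theorem IsWhitePeriod.isPeriod_add {B : Abacus ℓ} (hB : B.HasCylindricHeight e) (n : ℕ) :
    ∀ {k : ℤ} {Q : Fin ℓ → ℤ × Fin e}, 0 < k → IsWhitePeriod (k + n) B Q →
    IsPeriod ℓ {p | p ∈ (B.dual e).carrier ∧
      k ≤ B.height e ((p.2 : ℤ) + 1 - e + 1) p.1} Q := by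
  induction n with
  | zero =>
    intro k Q hk hQ
    rw [Nat.cast_zero, add_zero] at hQ
    exact .first (hQ.isFirstPeriod hB hk)
  | succ n ih =>
    intro k Q hk hQ
    obtain ⟨P, hP⟩ := exists_isWhitePeriod hB hk
    refine .next (hP.isFirstPeriod hB hk) ?_
    have h := ih (k := k + 1) (by omega) (Q := Q) (by
      rw [show k + 1 + n = k + ((n + 1 : ℕ) : ℤ) by push_cast; ring]
      exact hQ)
    convert h using 1
    ext ⟨R, j⟩
    rw [Set.mem_sdiff, hP.mem_range_iff hB hk]
    simp only [Set.mem_ofPred_eq, mem_dual_iff, mem_stack_iff_height]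
    have := height_succ_cases e B ((j : ℤ) + 1 - e) R
    constructor
    · rintro ⟨⟨h1, h2⟩, h3⟩
      exact ⟨h1, by omega⟩
    · rintro ⟨h1, h2⟩
      exact ⟨⟨h1, by omega⟩, by omega⟩

theorem IsWhitePeriod.isPeriod {B : Abacus ℓ} (hB : B.HasCylindricHeight e) {k : ℤ} (hk : 0 < k)
    {Q : Fin ℓ → ℤ × Fin e} (hQ : IsWhitePeriod k B Q) : IsPeriod ℓ (B.dual e).carrier Q := by
  obtain ⟨n, hn⟩ := Int.eq_ofNat_of_zero_le (show 0 ≤ k - 1 by omega)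
  have h := isPeriod_add hB n (k := 1) (Q := Q) one_pos (by
    rwa [show 1 + (n : ℤ) = k by omega])
  convert h using 1
  ext ⟨R, j⟩
  simp only [Set.mem_ofPred_eq, mem_dual_iff]
  refine ⟨fun h => ⟨h, ?_⟩, fun h => h.1⟩
  obtain ⟨b, h1, h2, h3⟩ := (notMem_stack_iff B _ _).1 h
  omega

/-- Lowering amounts to shifting a period in the dual abacus. -/
theorem IsLowering.isPeriodShift {a : ℤ} {C B : Abacus ℓ} (h : IsLowering e a C B) :
    IsPeriodShift ℓ (B.dual e) (C.dual e) := by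
  have ha := h.pos
  have hB := h.cylindric_right
  have hC := h.cylindric_left
  obtain ⟨P, hP⟩ := exists_isWhitePeriod hB ha
  -- The `a`-th white position of row `R` of `C` is that of row `R - 1` of `B`, while white
  -- positions of other ranks agree.
  have hsame : ∀ b > 0, b ≠ a → ∀ c R, b ≤ C.height e c R ↔ b ≤ B.height e c R := by
    intro b hb hne c R
    have h1 := h.level_eq b hb c
    rw [if_neg hne] at h1
    rw [← lt_level_iff hC hb, ← lt_level_iff hB hb]
    omega
  have hshift : ∀ c R, a ≤ C.height e c R ↔ a ≤ B.height e c (R - 1) := by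
    intro c R
    have h1 := h.level_eq a ha c
    rw [if_pos rfl] at h1
    rw [← lt_level_iff hC ha, ← lt_level_iff hB ha]
    omega
  have hnext : ∀ R j, (R, j) ∈ (Set.range fun i => ((P i).1 + 1, (P i).2)) ↔
      C.height e ((j : ℤ) + 1 - e) R < a ∧ a ≤ C.height e ((j : ℤ) + 1 - e + 1) R := by
    intro R j
    rw [← not_le, hshift, hshift, not_le, ← hP.mem_range_iff hB ha]
    refine exists_congr fun i => ?_
    rw [Prod.ext_iff, Prod.ext_iff]
    refine and_congr_left fun _ => ?_
    simp only
    omega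
  have hrest : ∀ R j, (R, j) ∈ (B.dual e).carrier \ Set.range P ↔ ∃ b > 0, b ≠ a ∧
      C.height e ((j : ℤ) + 1 - e) R < b ∧ b ≤ C.height e ((j : ℤ) + 1 - e + 1) R := by
    intro R j
    rw [Set.mem_sdiff, hP.mem_range_iff hB ha, mem_dual_iff, notMem_stack_iff]
    have h1 := height_succ_cases e B ((j : ℤ) + 1 - e) R
    constructor
    · rintro ⟨⟨b, hb, h2, h3⟩, h4⟩
      have hne : b ≠ a := by rintro rfl; exact h4 ⟨h2, h3⟩
      exact ⟨b, hb, hne, by rwa [← not_le, hsame b hb hne, not_le], (hsame b hb hne ..).2 h3⟩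
    · rintro ⟨b, hb, hne, h2, h3⟩
      rw [← not_le, hsame b hb hne, not_le] at h2
      rw [hsame b hb hne] at h3
      exact ⟨⟨b, hb, h2, h3⟩, by omega⟩
  refine ⟨P, hP.isPeriod hB ha, ?_, ?_⟩
  · rw [Set.disjoint_left]
    rintro ⟨R, j⟩ h1 h2
    obtain ⟨b, hb, hne, h3, h4⟩ := (hrest R j).1 h2
    have h5 := (hnext R j).1 h1
    have := height_succ_cases e C ((j : ℤ) + 1 - e) R
    omega
  · ext ⟨R, j⟩
    rw [Set.mem_union, hnext, hrest, mem_dual_iff, notMem_stack_iff]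
    constructor
    · rintro ⟨b, hb, h1, h2⟩
      by_cases hba : b = a
      · subst hba
        exact Or.inr ⟨h1, h2⟩
      · exact Or.inl ⟨b, hb, hba, h1, h2⟩
    · rintro (⟨b, hb, -, h1⟩ | h1)
      exacts [⟨b, hb, h1⟩, ⟨a, ha, h1⟩]

/-- The duals of FLOTW abaci have no incoming arrows in the Heisenberg crystal. -/
theorem HeisenbergArrow.not_isFLOTW (hℓ : 1 < ℓ) (he : 1 < e) {X Y : Abacus e}
    (h : HeisenbergArrow ℓ X Y) : ¬ (Y.dual ℓ).IsFLOTW e := by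
  induction h with
  | @shift X Y _ hY hs =>
    rw [isFLOTW_iff]
    rintro ⟨hc, hf⟩
    rw [← dual_dual (e := ℓ) Y] at hs
    obtain ⟨c, R, h1, h2⟩ := exists_height_pos_of_isPeriodShift hc hs
    obtain ⟨a, ha, hF⟩ := exists_isFull_of_isSource he hc hY.2 h1 h2
    exact hf a ha hF
  | @commute X Y X' Y' i _ _ hY _ =>
    rw [isFLOTW_iff]
    rintro ⟨hc, -⟩
    have hs := (isSource_dual_iff hℓ _).2 hc
    rw [dual_dual] at hs
    exact hs i Y hY
  -- Undoing the arrow preserves both the cylindric condition and the absence of full heights.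
  | @commute_dual X Y X' Y' i _ _ hY ih =>
    rw [isFLOTW_iff]
    rintro ⟨hc, hf⟩
    have hc' := hc.of_crystalArrow he hY
    refine ih ((isFLOTW_iff _).2 ⟨hc', fun a ha hF => hf a ha ?_⟩)
    exact (isFull_iff_of_crystalArrow he hc' hc hY ha).1 hF

/-- The duals of cylindric abaci that are not FLOTW have an incoming arrow in the Heisenberg
crystal. -/
theorem HasCylindricHeight.exists_heisenbergArrow (hℓ : 1 < ℓ) (he : 1 < e) {A : Abacus ℓ}
    (hA : A.HasCylindricHeight e) {a : ℤ} (ha : 0 < a) (hF : A.IsFull e a) :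
    ∃ B, IsLowering e a A B ∧ HeisenbergArrow ℓ (B.dual e) (A.dual e) := by
  -- The claim retains the lowering itself, since it is what carries a crystal arrow of `A` over to
  -- one of `B`.
  refine hA.crystal_induction (P := fun A => A.IsFull e a →
    ∃ B, IsLowering e a A B ∧ HeisenbergArrow ℓ (B.dual e) (A.dual e)) he ?_ ?_ hF
  · intro A hA hs hF
    obtain ⟨B, hB⟩ := exists_isLowering hA ha hF
    refine ⟨B, hB, .shift ⟨?_, ?_⟩ ⟨?_, ?_⟩ hB.isPeriodShift⟩
    · exact (isSource_dual_iff hℓ B).2 hB.cylindric_right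
    · rw [dual_dual]
      exact hB.isSource he hs
    · exact (isSource_dual_iff hℓ A).2 hA
    · rwa [dual_dual]
  · intro i A A' hA hA' harrow ih hF
    obtain ⟨B, hB, hBA⟩ := ih ((isFull_iff_of_crystalArrow he hA hA' harrow ha).2 hF)
    obtain ⟨B', hB'⟩ := exists_isLowering hA' ha hF
    refine ⟨B', hB', .commute_dual i hBA ?_ ?_⟩
    · rw [dual_dual, dual_dual]
      exact hB.crystalArrow hB' harrow
    · rwa [dual_dual, dual_dual]

end heisenberg
end Abacus

theorem theorem3p2 (ℓ e : ℕ) [NeZero ℓ] [NeZero e] (hℓ : 1 < ℓ) (he : 1 < e) (A : Abacus ℓ) :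
    (A.IsCylindric e ↔ (A.dual e).IsSource ℓ) ∧
    (A.IsFLOTW e ↔ (A.dual e).IsSource ℓ ∧ (A.dual e).IsHeisenbergSource ℓ) := by
  have h1 : A.IsCylindric e ↔ (A.dual e).IsSource ℓ := by
    rw [Abacus.isCylindric_iff, Abacus.isSource_dual_iff hℓ]
  refine ⟨h1, fun h => ⟨h1.1 h.1, fun B hB => ?_⟩, fun ⟨hs, hH⟩ => ?_⟩
  · refine hB.not_isFLOTW hℓ he ?_
    rwa [Abacus.dual_dual]
  · have hA := (Abacus.isSource_dual_iff hℓ A).1 hs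
    refine (Abacus.isFLOTW_iff A).2 ⟨hA, fun a ha hF => ?_⟩
    obtain ⟨B, -, hB⟩ := hA.exists_heisenbergArrow hℓ he ha hF
    exact hH _ hB
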